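/- For an ordinal $\alpha$, $n<\omega$ and $S\subseteq\alpha$, call $S$ a \emph{$\Pi^1_n$-indescribable} subset of $\alpha$ if for every $A\subseteq V_\alpha$ and every $\Pi^1_n$-sentence $\varphi$ with $(V_\alpha,\in,A)\models\varphi$ there is $\beta\in S$ with $(V_\beta,\in,A\cap V_\beta)\models\varphi$; the ordinal $\alpha$ is $\Pi^1_n$-indescribable if it is a $\Pi^1_n$-indescribable subset of itself. Call $S\subseteq\alpha$ a \emph{$\Pi^1_{-1}$-indescribable} subset of $\alpha$ if $\alpha$ is a limit ordinal and $S$ is unbounded in $\alpha$. For $n<\omega$ let $$\mathrm{Tr}_{n-1}(\kappa)=\{\alpha<\kappa : \alpha \text{ is a } \Pi^1_{n-1}\text{-indescribable subset of itself}\}.$$ A \emph{$0$-club} subset of $\alpha$ is a club in $\alpha$. For $n\ge 1$, an \emph{$n$-club} subset of $\alpha$ is a $\Pi^1_{n-1}$-indescribable set $C\subseteq\alpha$ such that $\beta\in C$ whenever $\beta<\alpha$ and $C\cap\beta$ is a $\Pi^1_{n-1}$-indescribable subset of $\beta$. For a cardinal $\kappa$ and $n<\omega$, the principle $\square_n(\kappa)$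 says that $\mathrm{Tr}_{n-1}(\kappa)$ is cofinal in $\kappa$ and there is a sequence $\langle C_\alpha:\alpha\in\mathrm{Tr}_{n-1}(\kappa)\rangle$ such that \begin{enumerate} \item for all $\alpha\in\mathrm{Tr}_{n-1}(\kappa)$, $C_\alpha$ is an $n$-club subset of $\alpha$; \item for all $\alpha<\beta$ in $\mathrm{Tr}_{n-1}(\kappa)$, if $C_\beta\cap\alpha$ is a $\Pi^1_{n-1}$-indescribable subset of $\alpha$, then $C_\alpha=C_\beta\cap\alpha$; \item there is no thread, that is, no $n$-club $C\subseteq\kappa$ such that for all $\alpha\in\mathrm{Tr}_{n-1}(\kappa)$, if $C\cap\alpha$ is a $\Pi^1_{n-1}$-indescribable subset of $\alpha$, then $C_\alpha=C\cap\alpha$. \end{enumerate} \textbf{Proposition.} For every cardinal $\kappa$ and every $n<\omega$, if $\square_n(\kappa)$ holds, then $\kappa$ is not $\Pi^1_{n+1}$-indescribable. (The case $n=0$, in which $\square_0(\kappa)$ is $\square(\kappa)$, is the classical fact that $\square(\kappa)$ refutes weak compactness, since the weakly compact cardinals are precisely the $\Pi^1_1$-indescribable ones.) -/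

import Mathlib

open Set
open scoped ZFSet

universe u

namespace Indescribability

/-- Relation symbols: membership, and `k` unary predicate symbols. (Equality is logical.) -/
inductive SetRel (k : ℕ) : ℕ → Type
  | mem : SetRel k 2
  | pred (i : Fin k) : SetRel k 1

/-- The language of set theory with `k` additional unary predicate symbols. -/
@[reducible]
def setLang (k : ℕ) : FirstOrder.Language.{0, 0} where
  Functions := fun _ => Empty
  Relations := SetRel k

/-- The structure `(V_α, ∈, X 0 ∩ V_α, …, X (k-1) ∩ V_α)`. -/
@[reducible]
def setStructure (α : Ordinal.{u}) {k : ℕ} (X : Fin k → ZFSet.{u}) :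
    (setLang k).Structure {x : ZFSet.{u} // x ∈ V_ α} where
  funMap := fun f => Empty.elim f
  RelMap := fun r v =>
    match r, v with
    | .mem, v => (v 0).1 ∈ (v 1).1
    | .pred i, v => (v 0).1 ∈ X i

/-- The two sides of the second-order hierarchy. -/
inductive Side
  | pi
  | sigma

/-- `SOFormula .pi n k` consists of the `Π¹ₙ`-formulas, and `SOFormula .sigma n k` of the
`Σ¹ₙ`-formulas, of the language of set theory whose free variables are `k` second-order
variables (unary predicates) and that have no free first-order variables: `n` alternating blocks
of second-order quantifiers, the first block being universal for `Π` and existential for `Σ`,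
followed by a first-order formula. A block may have any finite length `m`; the variables that it
binds are the last `m` of the `k + m` variables of its scope. -/
inductive SOFormula : Side → ℕ → ℕ → Type
  | firstOrder {s : Side} {k : ℕ} (φ : (setLang k).Sentence) : SOFormula s 0 k
  | all {n k : ℕ} (m : ℕ) (φ : SOFormula .sigma n (k + m)) : SOFormula .pi (n + 1) k
  | ex {n k : ℕ} (m : ℕ) (φ : SOFormula .pi n (k + m)) : SOFormula .sigma (n + 1) k

/-- `φ.Holds α X`: the formula `φ` is true in `(V_α, ∈)` when its free second-order variables are
interpreted by `X`. Second-order quantifiers range over all subsets of `V_α`. -/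
def SOFormula.Holds (α : Ordinal.{u}) :
    {s : Side} → {n k : ℕ} → SOFormula s n k → (Fin k → ZFSet.{u}) → Prop
  | _, _, _, .firstOrder φ, X =>
      @FirstOrder.Language.Sentence.Realize _ {x : ZFSet.{u} // x ∈ V_ α} (setStructure α X) φ
  | _, _, _, .all m φ, X =>
      ∀ Y : Fin m → ZFSet.{u}, (∀ i, Y i ⊆ V_ α) → φ.Holds α (Fin.append X Y)
  | _, _, _, .ex m φ, X =>
      ∃ Y : Fin m → ZFSet.{u}, (∀ i, Y i ⊆ V_ α) ∧ φ.Holds α (Fin.append X Y)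

/-- `S` is a `Π¹ₙ`-indescribable subset of the ordinal `κ`: for every `A ⊆ V_κ` and every
`Π¹ₙ`-sentence `φ`, if `(V_κ, ∈, A) ⊨ φ`, then `(V_α, ∈, A ∩ V_α) ⊨ φ` for some `α ∈ S`. -/
def IsIndescribableSet (n : ℕ) (κ : Ordinal.{u}) (S : Set Ordinal.{u}) : Prop :=
  S ⊆ Iio κ ∧
    ∀ A : ZFSet.{u}, A ⊆ V_ κ → ∀ φ : SOFormula .pi n 1, φ.Holds κ ![A] →
      ∃ α ∈ S, φ.Holds α ![A ∩ V_ α]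

/-- `κ` is `Π¹ₙ`-indescribable if `κ = {α | α < κ}` is a `Π¹ₙ`-indescribable subset of `κ`. -/
def IsIndescribable (n : ℕ) (κ : Ordinal.{u}) : Prop :=
  IsIndescribableSet n κ (Iio κ)

/-- `IsPrevIndescribableSet n κ S` says that `S` is a `Π¹ₙ₋₁`-indescribable subset of `κ`, where
`Π¹₋₁`-indescribable means that `κ` is a limit ordinal and `S` is unbounded in `κ`. -/
def IsPrevIndescribableSet : ℕ → Ordinal.{u} → Set Ordinal.{u} → Prop
  | 0, κ, S => Order.IsSuccLimit κ ∧ S ⊆ Iio κ ∧ ∀ β < κ, ∃ γ ∈ S, β < γ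
  | n + 1, κ, S => IsIndescribableSet n κ S

/-- `prevTrace n κ X` is `Trₙ₋₁(X) = {α < κ | X ∩ α is Π¹ₙ₋₁-indescribable in α}`. -/
def prevTrace (n : ℕ) (κ : Ordinal.{u}) (X : Set Ordinal.{u}) : Set Ordinal.{u} :=
  {α | α < κ ∧ IsPrevIndescribableSet n α (X ∩ Iio α)}

/-- `C` is an `n`-club subset of `κ`. A `0`-club is a club; for `n ≥ 1`, an `n`-club is a
`Π¹ₙ₋₁`-indescribable subset of `κ` that contains all `α < κ` such that `C ∩ α` is
`Π¹ₙ₋₁`-indescribable in `α`. -/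
def IsNClub : ℕ → Ordinal.{u} → Set Ordinal.{u} → Prop
  | 0, κ, C => C ⊆ Iio κ ∧ IsClub {x : Iio κ | x.1 ∈ C}
  | n + 1, κ, C => IsIndescribableSet n κ C ∧
      ∀ α < κ, IsIndescribableSet n α (C ∩ Iio α) → α ∈ C

/-- `⟨C_α : α ∈ Trₙ₋₁(κ)⟩` is a coherent sequence of `n`-clubs. Only the values of `C` at indices
in `Trₙ₋₁(κ)` matter. -/
def IsCoherentSeq (n : ℕ) (κ : Ordinal.{u}) (C : Ordinal.{u} → Set Ordinal.{u}) : Prop :=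
  (∀ α ∈ prevTrace n κ (Iio κ), IsNClub n α (C α)) ∧
    ∀ α ∈ prevTrace n κ (Iio κ), ∀ β ∈ prevTrace n κ (Iio κ), α < β →
      IsPrevIndescribableSet n α (C β ∩ Iio α) → C α = C β ∩ Iio α

/-- `D` is a thread through `⟨C_α : α ∈ Trₙ₋₁(κ)⟩`. -/
def IsThread (n : ℕ) (κ : Ordinal.{u}) (C : Ordinal.{u} → Set Ordinal.{u})
    (D : Set Ordinal.{u}) : Prop :=
  IsNClub n κ D ∧
    ∀ α ∈ prevTrace n κ (Iio κ), IsPrevIndescribableSet n α (D ∩ Iio α) → C α = D ∩ Iio α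

/-- The principle `□ₙ(κ)`: `Trₙ₋₁(κ)` is cofinal in `κ`, and there is a coherent sequence of
`n`-clubs indexed by `Trₙ₋₁(κ)` without a thread. -/
def SquarePrinciple (n : ℕ) (κ : Ordinal.{u}) : Prop :=
  (∀ β < κ, ∃ α ∈ prevTrace n κ (Iio κ), β ≤ α) ∧
    ∃ C : Ordinal.{u} → Set Ordinal.{u}, IsCoherentSeq n κ C ∧ ¬ ∃ D, IsThread n κ C D

end Indescribability

/-!
Suppose that `κ` is `Π¹ₙ₊₁`-indescribable and carries a coherent sequence `C`. If `C` has no thread,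
then "no subset of `κ` is a thread of `C`" is a `Π¹ₙ₊₁`-statement about `V_κ`, since being a
`Π¹ₙ₋₁`-indescribable subset is a `Π¹ₙ`-property. Together with the `Π¹ₙ`-statement that `κ` is
`Π¹ₙ₋₁`-indescribable, it reflects to some `α < κ`. Then `α` is an index of the sequence, and `C α`
is a thread of the sequence below `α` by coherence: a contradiction.

The complexity bounds need a universal `Π¹ₘ`-property. It is obtained without coding syntax. A
property of a class `J` over `V_β` is called a local `Π¹ₙ`-property (`LocalPi`) if one relation
`R` brings it, for all limit `β`, into the form of `n` alternating class quantifiers followed by a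
matrix `∀ c ∃ d, R c d (J ∩ d)` over the elements of `V_β`. The relation `R` is an arbitrary
relation between sets, so anything that is decided inside a set, such as all that concerns ordinals
below `β`, is free of charge. The argument rests on three facts.

* Truth of `Π¹ₙ`-formulas is a local `Π¹ₙ`-property for `n ≥ 1` (`localPi_holds`). Truth of a
  first-order sentence says that there is a class of truth data according to which it is true, and
  the Tarski clauses for the truth data have local matrices (`exists_truth_data`). For `n = 0` the
  truth data over `V_κ` serve as a parameter (`exists_universal_of_holds`).
* A relation `R` restricted to `V_β` can be coded by a subset of `V_β`, and then the normal form
  with relation `R` is expressed by one fixed `Π¹ₙ`-formula (`exists_formula_universal`). Hence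
  `Π¹ₙ`-indescribable sets reflect all local `Π¹ₙ`-properties
  (`IsIndescribableSet.exists_of_localPi`), and `Π¹ₙ`-indescribability amounts to reflecting the
  instances of the universal one (`isIndescribableSet_iff`).
* Consequently `Π¹ₙ₋₁`-indescribability is a local `Π¹ₙ`-property
  (`localPi_isPrevIndescribableSet`), and so is being a thread (`localPi_codesThread`).
-/

namespace Indescribability

open Order ZFSet FirstOrder.Language

/-! ### Tagged joins of classes and maps of bounded modulus -/

/-- The disjoint union of two classes of sets, with the tags `∅` and `{∅}`. It codes two classes by
one. -/
def join (J Y : Set ZFSet.{u}) : Set ZFSet.{u} :=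
  {z | (∃ x ∈ J, z = pair ∅ x) ∨ ∃ y ∈ Y, z = pair {∅} y}

/-- The class that is coded by `J` at the tag `t`. -/
def part (t : ZFSet.{u}) (J : Set ZFSet.{u}) : Set ZFSet.{u} := {x | pair t x ∈ J}

/-- The left component of a join. -/
def left (J : Set ZFSet.{u}) : Set ZFSet.{u} := part ∅ J

/-- The right component of a join. -/
def right (J : Set ZFSet.{u}) : Set ZFSet.{u} := part {∅} J

theorem mem_left {J : Set ZFSet.{u}} {x : ZFSet.{u}} : x ∈ left J ↔ pair ∅ x ∈ J := Iff.rfl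

theorem mem_right {J : Set ZFSet.{u}} {x : ZFSet.{u}} : x ∈ right J ↔ pair {∅} x ∈ J := Iff.rfl

theorem empty_ne_singleton_empty : (∅ : ZFSet.{u}) ≠ {∅} := by
  intro h
  simpa using congrArg rank h

@[simp]
theorem left_join (J Y : Set ZFSet.{u}) : left (join J Y) = J := by
  ext x
  simp [mem_left, join, pair_inj, empty_ne_singleton_empty]

@[simp]
theorem right_join (J Y : Set ZFSet.{u}) : right (join J Y) = Y := by
  ext x
  simp [mem_right, join, pair_inj, empty_ne_singleton_empty.symm]

theorem rank_pair_eq (x y : ZFSet.{u}) : rank (pair x y) = max (rank x) (rank y) + 2 := by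
  have h : (2 : Ordinal.{u}) = 1 + 1 := one_add_one_eq_two.symm
  rw [h, ← add_assoc, ← succ_eq_add_one, ← succ_eq_add_one]
  simp [pair, max_add_add_right]

theorem rank_right_le_rank_pair (x y : ZFSet.{u}) : rank y ≤ rank (pair x y) := by
  rw [rank_pair_eq]; exact (le_max_right _ _).trans le_self_add

theorem rank_left_le_rank_pair (x y : ZFSet.{u}) : rank x ≤ rank (pair x y) := by
  rw [rank_pair_eq]; exact (le_max_left _ _).trans le_self_add

theorem add_natCast_lt_of_isSuccLimit {α β : Ordinal.{u}} (hβ : IsSuccLimit β) (h : α < β) (k : ℕ) :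
    α + k < β := by
  induction k with
  | zero => simpa using h
  | succ k ih =>
    rw [Nat.cast_succ, ← add_assoc, ← succ_eq_add_one]
    exact hβ.succ_lt ih

theorem pair_mem_vonNeumann {β : Ordinal.{u}} (hβ : IsSuccLimit β) {x y : ZFSet.{u}} :
    pair x y ∈ V_ β ↔ x ∈ V_ β ∧ y ∈ V_ β := by
  simp only [mem_vonNeumann]
  constructor
  · intro h
    exact ⟨(rank_left_le_rank_pair x y).trans_lt h, (rank_right_le_rank_pair x y).trans_lt h⟩
  · rintro ⟨hx, hy⟩
    rw [rank_pair_eq]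
    exact_mod_cast add_natCast_lt_of_isSuccLimit hβ (max_lt hx hy) 2

theorem empty_mem_vonNeumann {β : Ordinal.{u}} (hβ : IsSuccLimit β) : (∅ : ZFSet.{u}) ∈ V_ β := by
  simpa [mem_vonNeumann] using hβ.bot_lt

theorem singleton_empty_mem_vonNeumann {β : Ordinal.{u}} (hβ : IsSuccLimit β) :
    ({∅} : ZFSet.{u}) ∈ V_ β := by
  simpa [mem_vonNeumann] using hβ.succ_lt hβ.bot_lt

/-- `J` and `J'` have the same elements of rank at most `α`. -/
def AgreeUpTo (α : Ordinal.{u}) (J J' : Set ZFSet.{u}) : Prop :=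
  ∀ x, rank x ≤ α → (x ∈ J ↔ x ∈ J')

theorem AgreeUpTo.symm {α : Ordinal.{u}} {J J' : Set ZFSet.{u}} (h : AgreeUpTo α J J') :
    AgreeUpTo α J' J := fun x hx => (h x hx).symm

theorem AgreeUpTo.mono {α β : Ordinal.{u}} {J J' : Set ZFSet.{u}} (h : AgreeUpTo β J J')
    (hαβ : α ≤ β) : AgreeUpTo α J J' := fun x hx => h x (hx.trans hαβ)

/-- An operation `σ` on classes has bounded modulus if there is a finite `k` such that `σ J` up to
any rank `α` depends only on `J` up to rank `α + k`. A finite `k` keeps the dependence below every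
limit ordinal. -/
def BoundedModulus (σ : Set ZFSet.{u} → Set ZFSet.{u}) : Prop :=
  ∃ k : ℕ, ∀ (x : ZFSet.{u}) (J J' : Set ZFSet.{u}),
    AgreeUpTo (rank x + k) J J' → (x ∈ σ J ↔ x ∈ σ J')

theorem BoundedModulus.id : BoundedModulus (fun J : Set ZFSet.{u} => J) :=
  ⟨0, fun x _ _ h => h x (by simp)⟩

theorem BoundedModulus.const (A : Set ZFSet.{u}) : BoundedModulus (fun _ => A) :=
  ⟨0, fun _ _ _ _ => Iff.rfl⟩

theorem BoundedModulus.agreeUpTo {σ : Set ZFSet.{u} → Set ZFSet.{u}} {k : ℕ}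
    (hσ : ∀ (x : ZFSet.{u}) (J J' : Set ZFSet.{u}),
      AgreeUpTo (rank x + k) J J' → (x ∈ σ J ↔ x ∈ σ J'))
    {α : Ordinal.{u}} {J J' : Set ZFSet.{u}} (h : AgreeUpTo (α + k) J J') :
    AgreeUpTo α (σ J) (σ J') :=
  fun x hx => hσ x J J' (h.mono (by gcongr))

theorem BoundedModulus.comp {σ τ : Set ZFSet.{u} → Set ZFSet.{u}} (hσ : BoundedModulus σ)
    (hτ : BoundedModulus τ) : BoundedModulus (fun J => σ (τ J)) := by
  obtain ⟨k, hk⟩ := hσ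
  obtain ⟨l, hl⟩ := hτ
  refine ⟨k + l, fun x J J' h => hk x _ _ (BoundedModulus.agreeUpTo hl ?_)⟩
  simpa [add_assoc] using h

theorem BoundedModulus.part_natCast (i : ℕ) :
    BoundedModulus (part (i : Ordinal.{u}).toZFSet) := by
  refine ⟨i + 2, fun x J J' h => h _ ?_⟩
  rw [rank_pair_eq, Ordinal.rank_toZFSet, Nat.cast_add, ← add_assoc]
  gcongr
  · exact max_le le_add_self le_self_add
  · simp

theorem BoundedModulus.left : BoundedModulus (left : Set ZFSet.{u} → Set ZFSet.{u}) := by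
  have h := BoundedModulus.part_natCast.{u} 0
  rwa [Nat.cast_zero, Ordinal.toZFSet_zero] at h

theorem BoundedModulus.right : BoundedModulus (right : Set ZFSet.{u} → Set ZFSet.{u}) := by
  have h := BoundedModulus.part_natCast.{u} 1
  have h1 : ((1 : ℕ) : Ordinal.{u}).toZFSet = {∅} := by
    have := Ordinal.toZFSet_add_one 0
    rw [Nat.cast_one, ← zero_add 1, this, Ordinal.toZFSet_zero]
    ext; simp
  rwa [h1] at h

theorem BoundedModulus.join {σ τ : Set ZFSet.{u} → Set ZFSet.{u}} (hσ : BoundedModulus σ)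
    (hτ : BoundedModulus τ) : BoundedModulus (fun J => join (σ J) (τ J)) := by
  obtain ⟨k, hk⟩ := hσ
  obtain ⟨l, hl⟩ := hτ
  refine ⟨k + l, fun x J J' h => or_congr ?_ ?_⟩
  · refine exists_congr fun y => and_congr_left ?_
    rintro rfl
    exact hk y J J' (h.mono (add_le_add (rank_right_le_rank_pair _ _) (by simp)))
  · refine exists_congr fun y => and_congr_left ?_
    rintro rfl
    exact hl y J J' (h.mono (add_le_add (rank_right_le_rank_pair _ _) (by simp)))

/-- `Δ c y J` is local if there is a finite `k` such that its truth depends only on the elements of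
`J` whose rank is at most `max (rank c) (rank y) + k`. -/
def IsLocal (Δ : ZFSet.{u} → ZFSet.{u} → Set ZFSet.{u} → Prop) : Prop :=
  ∃ k : ℕ, ∀ (c y : ZFSet.{u}) (J J' : Set ZFSet.{u}),
    AgreeUpTo (max (rank c) (rank y) + k) J J' → Δ c y J → Δ c y J'

theorem IsLocal.not {Δ : ZFSet.{u} → ZFSet.{u} → Set ZFSet.{u} → Prop} (h : IsLocal Δ) :
    IsLocal (fun c y J => ¬ Δ c y J) := by
  obtain ⟨k, hk⟩ := h
  exact ⟨k, fun c y J J' hJ hn h' => hn (hk c y J' J hJ.symm h')⟩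

theorem IsLocal.imp {Δ Δ' : ZFSet.{u} → ZFSet.{u} → Set ZFSet.{u} → Prop} (h : IsLocal Δ)
    (h' : IsLocal Δ') : IsLocal (fun c y J => Δ c y J → Δ' c y J) := by
  obtain ⟨k, hk⟩ := h
  obtain ⟨l, hl⟩ := h'
  refine ⟨k + l, fun c y J J' hJ hi hΔ => ?_⟩
  refine hl c y J J' (hJ.mono (by gcongr; simp)) (hi (hk c y J' J (hJ.symm.mono ?_) hΔ))
  gcongr; simp

theorem IsLocal.and {Δ Δ' : ZFSet.{u} → ZFSet.{u} → Set ZFSet.{u} → Prop} (h : IsLocal Δ)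
    (h' : IsLocal Δ') : IsLocal (fun c y J => Δ c y J ∧ Δ' c y J) := by
  simpa only [Classical.not_imp, not_not] using (h.imp h'.not).not

theorem IsLocal.iff {Δ Δ' : ZFSet.{u} → ZFSet.{u} → Set ZFSet.{u} → Prop} (h : IsLocal Δ)
    (h' : IsLocal Δ') : IsLocal (fun c y J => Δ c y J ↔ Δ' c y J) := by
  simpa [iff_def] using (h.imp h').and (h'.imp h)

theorem IsLocal.const (q : ZFSet.{u} → ZFSet.{u} → Prop) : IsLocal (fun c y _ => q c y) :=
  ⟨0, fun _ _ _ _ _ h => h⟩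

theorem IsLocal.comp {Δ : ZFSet.{u} → ZFSet.{u} → Set ZFSet.{u} → Prop} (h : IsLocal Δ)
    {σ : Set ZFSet.{u} → Set ZFSet.{u}} (hσ : BoundedModulus σ) :
    IsLocal (fun c y J => Δ c y (σ J)) := by
  obtain ⟨k, hk⟩ := h
  obtain ⟨l, hl⟩ := hσ
  refine ⟨k + l, fun c y J J' hJ => hk c y _ _ (BoundedModulus.agreeUpTo hl ?_)⟩
  simpa [add_assoc] using hJ

/-- Local conditions may be evaluated at sets of bounded rank that are computed from `c` and `y`. -/
theorem IsLocal.exists {Δ : ZFSet.{u} → ZFSet.{u} → Set ZFSet.{u} → Prop} (h : IsLocal Δ)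
    (p : ZFSet.{u} → ZFSet.{u} → ZFSet.{u} → ZFSet.{u} → Prop) (l : ℕ)
    (hp : ∀ c y c' y', p c y c' y' → max (rank c') (rank y') ≤ max (rank c) (rank y) + l) :
    IsLocal (fun c y J => ∃ c' y', p c y c' y' ∧ Δ c' y' J) := by
  obtain ⟨k, hk⟩ := h
  refine ⟨l + k, fun c y J J' hJ => ?_⟩
  rintro ⟨c', y', hcy, hΔ⟩
  refine ⟨c', y', hcy, hk c' y' J J' (hJ.mono ?_) hΔ⟩
  rw [Nat.cast_add, ← add_assoc]
  gcongr
  exact hp _ _ _ _ hcy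

theorem IsLocal.mem_left : IsLocal (fun c (_ : ZFSet.{u}) J => c ∈ J) :=
  ⟨0, fun c _ _ _ h => (h c (by simp)).1⟩

theorem IsLocal.mem_right : IsLocal (fun (_ : ZFSet.{u}) y J => y ∈ J) :=
  ⟨0, fun _ y _ _ h => (h y (by simp)).1⟩

theorem sep_eq_sep {d : ZFSet.{u}} {J J' : Set ZFSet.{u}} {α : Ordinal.{u}}
    (h : AgreeUpTo α J J') (hd : rank d ≤ α) : d.sep (· ∈ J) = d.sep (· ∈ J') := by
  ext x
  simp only [ZFSet.mem_sep]
  exact and_congr_right fun hx => h x ((rank_lt_of_mem hx).le.trans hd)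

theorem IsLocal.sep_right (R : ZFSet.{u} → ZFSet.{u} → ZFSet.{u} → Prop) :
    IsLocal (fun c d J => R c d (d.sep (· ∈ J))) := by
  refine ⟨0, fun c d J J' h hR => ?_⟩
  have hs := sep_eq_sep h ((le_max_right _ _).trans le_self_add)
  simpa only [← hs] using hR

/-! ### The local hierarchy -/

/-- The normal form for `Π¹ₙ`-properties of a class `J` over `V_β`: `n` alternating quantifiers
over classes, and a matrix `∀ c ∃ d` over the elements of `V_β` in which the class that codes `J`
and the quantified classes occurs only through its intersection with `d`. The relation `R` is
arbitrary, so that no syntax is involved. -/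
def NormalForm (β : Ordinal.{u}) (R : ZFSet.{u} → ZFSet.{u} → ZFSet.{u} → Prop) :
    ℕ → Set ZFSet.{u} → Prop
  | 0, J => ∀ c ∈ V_ β, ∃ d ∈ V_ β, R c d (d.sep (· ∈ J))
  | n + 1, J => ∀ Y : Set ZFSet.{u}, ¬ NormalForm β R n (join J Y)

/-- `P` is a local `Π¹ₙ`-property: a single relation `R` brings it into normal form at all limit
ordinals. -/
def LocalPi (n : ℕ) (P : Ordinal.{u} → Set ZFSet.{u} → Prop) : Prop :=
  ∃ R : ZFSet.{u} → ZFSet.{u} → ZFSet.{u} → Prop, ∀ β, IsSuccLimit β → ∀ J,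
    (P β J ↔ NormalForm β R n J)

variable {n : ℕ} {P Q : Ordinal.{u} → Set ZFSet.{u} → Prop}

theorem LocalPi.congr (hP : LocalPi n P) (h : ∀ β, IsSuccLimit β → ∀ J, (Q β J ↔ P β J)) :
    LocalPi n Q := by
  obtain ⟨R, hR⟩ := hP
  exact ⟨R, fun β hβ J => (h β hβ J).trans (hR β hβ J)⟩

theorem localPi_succ_iff : LocalPi (n + 1) P ↔
    ∃ Q, LocalPi n Q ∧ ∀ β, IsSuccLimit β → ∀ J, (P β J ↔ ∀ Y, ¬ Q β (join J Y)) := by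
  constructor
  · rintro ⟨R, hR⟩
    exact ⟨fun β J => NormalForm β R n J, ⟨R, fun _ _ _ => Iff.rfl⟩, hR⟩
  · rintro ⟨Q, ⟨R, hR⟩, hQ⟩
    refine ⟨R, fun β hβ J => (hQ β hβ J).trans ?_⟩
    exact forall_congr' fun Y => not_congr (hR β hβ _)

theorem LocalPi.forall_not (hQ : LocalPi n Q) :
    LocalPi (n + 1) (fun β J => ∀ Y, ¬ Q β (join J Y)) :=
  localPi_succ_iff.2 ⟨Q, hQ, fun _ _ _ => Iff.rfl⟩

/-- The matrix of a normal form may be any local condition: `d` is taken to be a level of the von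
Neumann hierarchy that contains the witness `y` and all that the condition depends on. -/
theorem IsLocal.localPi_zero {Δ : ZFSet.{u} → ZFSet.{u} → Set ZFSet.{u} → Prop} (h : IsLocal Δ) :
    LocalPi 0 (fun β J => ∀ c ∈ V_ β, ∃ y ∈ V_ β, Δ c y J) := by
  obtain ⟨k, hk⟩ := h
  refine ⟨fun c d j => ∃ y ∈ d, V_ (max (rank c) (rank y) + k + 1) ⊆ d ∧ Δ c y {x | x ∈ j},
    fun β hβ J => forall₂_congr fun c hc => ?_⟩
  have key : ∀ y d : ZFSet.{u}, V_ (max (rank c) (rank y) + k + 1) ⊆ d →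
      AgreeUpTo (max (rank c) (rank y) + k) J {x | x ∈ d.sep (· ∈ J)} := by
    intro y d hd x hx
    simp only [mem_ofPred_eq, ZFSet.mem_sep]
    exact ⟨fun h => ⟨hd (mem_vonNeumann.2 (hx.trans_lt (lt_add_one _))), h⟩, fun h => h.2⟩
  constructor
  · rintro ⟨y, hy, hΔ⟩
    refine ⟨V_ (max (rank c) (rank y) + k + 1), ?_, y, ?_, subset_rfl, ?_⟩
    · rw [mem_vonNeumann] at hc hy
      rw [vonNeumann_mem_vonNeumann_iff]
      exact hβ.succ_lt (add_natCast_lt_of_isSuccLimit hβ (max_lt hc hy) k)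
    · rw [mem_vonNeumann, add_assoc]
      exact (le_max_right _ _).trans_lt (lt_add_of_pos_right _ (by simp))
    · exact hk c y _ _ (key y _ subset_rfl) hΔ
  · rintro ⟨d, hd, y, hy, hyd, hΔ⟩
    refine ⟨y, isTransitive_vonNeumann β _ hd hy, ?_⟩
    exact hk c y _ _ (key y _ hyd).symm hΔ

/-- The `Π₁`-instance of `IsLocal.localPi_zero`. -/
theorem IsLocal.localPi_zero_forall {Δ : ZFSet.{u} → ZFSet.{u} → Set ZFSet.{u} → Prop}
    (h : IsLocal (fun c (_ : ZFSet.{u}) J => Δ c c J)) :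
    LocalPi 0 (fun β J => ∀ c ∈ V_ β, Δ c c J) := by
  refine h.localPi_zero.congr fun β hβ J => forall₂_congr fun c hc => ?_
  exact ⟨fun h => ⟨c, hc, h⟩, fun ⟨_, _, h⟩ => h⟩

/-- The `Σ₁`-instance of `IsLocal.localPi_zero`. -/
theorem IsLocal.localPi_zero_exists {Δ : ZFSet.{u} → ZFSet.{u} → Set ZFSet.{u} → Prop}
    (h : IsLocal (fun (_ : ZFSet.{u}) y J => Δ y y J)) :
    LocalPi 0 (fun β J => ∃ y ∈ V_ β, Δ y y J) := by
  refine h.localPi_zero.congr fun β hβ J => ?_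
  exact ⟨fun h _ _ => h, fun h => h ∅ (empty_mem_vonNeumann hβ)⟩

/-- Substitution into a normal form: the operation `σ` is moved inwards past each class quantifier,
by acting on the left component of the join only. -/
theorem LocalPi.comp {σ : Set ZFSet.{u} → Set ZFSet.{u}} (hP : LocalPi n P)
    (hσ : BoundedModulus σ) : LocalPi n (fun β J => P β (σ J)) := by
  induction n generalizing P σ with
  | zero =>
    obtain ⟨R, hR⟩ := hP
    exact ((IsLocal.sep_right R).comp hσ).localPi_zero.congr fun β hβ J => hR β hβ (σ J)
  | succ n ih =>
    obtain ⟨Q, hQ, hPQ⟩ := localPi_succ_iff.1 hP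
    refine localPi_succ_iff.2 ⟨fun β J => Q β (join (σ (left J)) (right J)),
      ih hQ ((hσ.comp .left).join .right), fun β hβ J => ?_⟩
    simpa using hPQ β hβ (σ J)

theorem LocalPi.and_or_zero (hP : LocalPi 0 P) (hQ : LocalPi 0 Q) :
    LocalPi 0 (fun β J => P β J ∧ Q β J) ∧ LocalPi 0 (fun β J => P β J ∨ Q β J) := by
  obtain ⟨R, hR⟩ := hP
  obtain ⟨S, hS⟩ := hQ
  have hle : ∀ a c d : ZFSet.{u}, rank a ≤ rank c → max (rank a) (rank d) ≤
      max (rank c) (rank d) + (0 : ℕ) := fun a c d h => by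
    rw [Nat.cast_zero, add_zero]; exact max_le_max_right _ h
  constructor
  · have h1 := (IsLocal.sep_right R).exists (fun c y c' d => c' = c ∧ ∃ e, y = pair d e) 0 (by
      rintro c y c' d ⟨rfl, e, rfl⟩
      rw [Nat.cast_zero, add_zero]
      exact max_le_max_left _ (rank_left_le_rank_pair d e))
    have h2 := (IsLocal.sep_right S).exists (fun c y c' d => c' = c ∧ ∃ e, y = pair e d) 0 (by
      rintro c y c' d ⟨rfl, e, rfl⟩
      rw [Nat.cast_zero, add_zero]
      exact max_le_max_left _ (rank_right_le_rank_pair e d))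
    refine (h1.and h2).localPi_zero.congr fun β hβ J => ?_
    rw [hR β hβ, hS β hβ]
    constructor
    · rintro ⟨h1, h2⟩ c hc
      obtain ⟨d, hd, hd'⟩ := h1 c hc
      obtain ⟨e, he, he'⟩ := h2 c hc
      exact ⟨pair d e, (pair_mem_vonNeumann hβ).2 ⟨hd, he⟩, ⟨c, d, ⟨rfl, e, rfl⟩, hd'⟩,
        ⟨c, e, ⟨rfl, d, rfl⟩, he'⟩⟩
    · intro h
      constructor <;> intro c hc
      · obtain ⟨_, hy, ⟨_, d, ⟨rfl, e, rfl⟩, hd⟩, -⟩ := h c hc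
        exact ⟨d, ((pair_mem_vonNeumann hβ).1 hy).1, hd⟩
      · obtain ⟨_, hy, -, ⟨_, e, ⟨rfl, d, rfl⟩, he⟩⟩ := h c hc
        exact ⟨e, ((pair_mem_vonNeumann hβ).1 hy).2, he⟩
  · have h1 := (IsLocal.sep_right R).exists (fun c y c' d => d = y ∧ ∃ e, c = pair c' e) 0 (by
      rintro c y c' d ⟨rfl, e, rfl⟩
      exact hle _ _ _ (rank_left_le_rank_pair c' e))
    have h2 := (IsLocal.sep_right S).exists (fun c y c' d => d = y ∧ ∃ e, c = pair e c') 0 (by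
      rintro c y c' d ⟨rfl, e, rfl⟩
      exact hle _ _ _ (rank_right_le_rank_pair e c'))
    refine ((IsLocal.const fun c _ => ∃ a b, c = pair a b).imp
      (h1.not.imp h2)).localPi_zero.congr fun β hβ J => ?_
    rw [hR β hβ, hS β hβ]
    constructor
    · rintro (h | h) c hc
      · by_cases hp : ∃ a b, c = pair a b
        · obtain ⟨a, b, rfl⟩ := hp
          obtain ⟨d, hd, hd'⟩ := h a ((pair_mem_vonNeumann hβ).1 hc).1
          exact ⟨d, hd, fun _ hn => (hn ⟨a, d, ⟨rfl, b, rfl⟩, hd'⟩).elim⟩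
        · exact ⟨c, hc, fun h => (hp h).elim⟩
      · by_cases hp : ∃ a b, c = pair a b
        · obtain ⟨a, b, rfl⟩ := hp
          obtain ⟨d, hd, hd'⟩ := h b ((pair_mem_vonNeumann hβ).1 hc).2
          exact ⟨d, hd, fun _ _ => ⟨b, d, ⟨rfl, a, rfl⟩, hd'⟩⟩
        · exact ⟨c, hc, fun h => (hp h).elim⟩
    · intro h
      by_contra! hcon
      obtain ⟨h1, h2⟩ := hcon
      simp only [NormalForm, not_forall] at h1 h2
      obtain ⟨a, ha, hna⟩ := h1
      obtain ⟨b, hb, hnb⟩ := h2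
      obtain ⟨d, hd, hd'⟩ := h (pair a b) ((pair_mem_vonNeumann hβ).2 ⟨ha, hb⟩)
      obtain ⟨b', _, ⟨rfl, a', hab⟩, hS⟩ := hd' ⟨a, b, rfl⟩ (by
        rintro ⟨a', _, ⟨rfl, b', hab⟩, hR⟩
        obtain ⟨rfl, rfl⟩ := pair_inj.1 hab
        exact hna ⟨_, hd, hR⟩)
      obtain ⟨rfl, rfl⟩ := pair_inj.1 hab
      exact hnb ⟨_, hd, hS⟩

/-- Conjunctions and disjunctions are treated together, since the negation in `NormalForm` swaps
them at each step. -/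
theorem LocalPi.and_or (hP : LocalPi n P) (hQ : LocalPi n Q) :
    LocalPi n (fun β J => P β J ∧ Q β J) ∧ LocalPi n (fun β J => P β J ∨ Q β J) := by
  induction n generalizing P Q with
  | zero => exact hP.and_or_zero hQ
  | succ n ih =>
    obtain ⟨P', hP', hP⟩ := localPi_succ_iff.1 hP
    obtain ⟨Q', hQ', hQ⟩ := localPi_succ_iff.1 hQ
    -- The two quantified classes are the two components of a single one.
    have h1 := hP'.comp (BoundedModulus.left.join (BoundedModulus.left.comp .right))
    have h2 := hQ'.comp (BoundedModulus.left.join (BoundedModulus.right.comp .right))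
    obtain ⟨hand, hor⟩ := ih h1 h2
    refine ⟨hor.forall_not.congr fun β hβ J => ?_, hand.forall_not.congr fun β hβ J => ?_⟩ <;>
      simp only [hP β hβ, hQ β hβ, left_join, right_join]
    · refine ⟨fun h Y => not_or.2 ⟨h.1 _, h.2 _⟩, fun h => ⟨fun Y => ?_, fun Y => ?_⟩⟩
      · simpa using (not_or.1 (h (join Y ∅))).1
      · simpa using (not_or.1 (h (join ∅ Y))).2
    · constructor
      · rintro (h | h) Y hY
        exacts [h _ hY.1, h _ hY.2]
      · intro h
        by_contra! hcon
        obtain ⟨⟨Y, hY⟩, ⟨Z, hZ⟩⟩ := hcon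
        exact h (join Y Z) (by simpa using ⟨hY, hZ⟩)

theorem LocalPi.and (hP : LocalPi n P) (hQ : LocalPi n Q) :
    LocalPi n (fun β J => P β J ∧ Q β J) := (hP.and_or hQ).1

/-- Adjacent universal class quantifiers are contracted to a single one. -/
theorem LocalPi.forall (hP : LocalPi (n + 1) P) :
    LocalPi (n + 1) (fun β J => ∀ Y, P β (join J Y)) := by
  obtain ⟨Q, hQ, hPQ⟩ := localPi_succ_iff.1 hP
  have h := hQ.comp ((BoundedModulus.left.join (BoundedModulus.left.comp .right)).join
    (BoundedModulus.right.comp .right))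
  refine h.forall_not.congr fun β hβ J => ?_
  simp only [hPQ β hβ, left_join, right_join]
  exact ⟨fun h Y => h _ _, fun h Y Z => by simpa using h (join Y Z)⟩

/-- Local `Π¹ₙ`-properties are local `Π¹ₙ₊₁`-properties. For `n = 0`, the outermost first-order
quantifier `∃ c` of the negation is traded for the class quantifier "there is a nonempty class of
such `c`". -/
theorem LocalPi.succ (hP : LocalPi n P) : LocalPi (n + 1) P := by
  induction n generalizing P with
  | zero =>
    obtain ⟨R, hR⟩ := hP
    have h1 : LocalPi 0 (fun (β : Ordinal.{u}) J => ∃ y ∈ V_ β, y ∈ right J) :=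
      IsLocal.localPi_zero_exists (Δ := fun _ y J => y ∈ right J) (IsLocal.mem_right.comp .right)
    have h2 : IsLocal (fun c (_ : ZFSet.{u}) J => ∃ a b, c = pair a b ∧
        (a ∈ right J ∧ R a b (b.sep (· ∈ left J)))) :=
      ((IsLocal.mem_left.comp .right).and ((IsLocal.sep_right R).comp .left)).exists
        (fun c _ a b => c = pair a b) 0 (by
          rintro _ y a b rfl
          rw [Nat.cast_zero, add_zero]
          exact le_max_of_le_left
            (max_le (rank_left_le_rank_pair a b) (rank_right_le_rank_pair a b)))
    have h3 := IsLocal.localPi_zero_forall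
      (Δ := fun c _ J => ¬ ∃ a b, c = pair a b ∧ (a ∈ right J ∧ R a b (b.sep (· ∈ left J)))) h2.not
    refine (h1.and h3).forall_not.congr fun β hβ J => ?_
    simp only [hR β hβ, left_join, right_join]
    constructor
    · rintro h Y ⟨⟨c, hc, hcY⟩, hn⟩
      obtain ⟨d, hd, hcd⟩ := h c hc
      exact hn (pair c d) ((pair_mem_vonNeumann hβ).2 ⟨hc, hd⟩) ⟨c, d, rfl, hcY, hcd⟩
    · intro h c hc
      by_contra hn
      refine h {c} ⟨⟨c, hc, rfl⟩, ?_⟩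
      rintro _ hp ⟨a, b, rfl, rfl, hR⟩
      exact hn ⟨b, ((pair_mem_vonNeumann hβ).1 hp).2, hR⟩
  | succ n ih =>
    obtain ⟨Q, hQ, hPQ⟩ := localPi_succ_iff.1 hP
    exact (ih hQ).forall_not.congr hPQ

theorem LocalPi.mono {m : ℕ} (hP : LocalPi m P) (h : m ≤ n) : LocalPi n P := by
  induction n, h using Nat.le_induction with
  | base => exact hP
  | succ _ _ ih => exact ih.succ

/-! ### First-order truth -/

/-- The restriction of a family of classes to `V_β`. -/
noncomputable def restrict (β : Ordinal.{u}) {k : ℕ} (X : Fin k → Set ZFSet.{u}) :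
    Fin k → ZFSet.{u} :=
  fun i => (V_ β).sep (· ∈ X i)

/-- The code of a finite sequence of sets, as iterated pairs. -/
def tuple : (l : ℕ) → (Fin l → ZFSet.{u}) → ZFSet.{u}
  | 0, _ => ∅
  | l + 1, v => pair (v (Fin.last l)) (tuple l (Fin.init v))

theorem tuple_injective (l : ℕ) : Function.Injective (tuple.{u} l) := by
  induction l with
  | zero => exact fun v w _ => Subsingleton.elim v w
  | succ l ih =>
    intro v w h
    obtain ⟨h1, h2⟩ := pair_inj.1 h
    rw [← Fin.snoc_init_self v, ← Fin.snoc_init_self w, ih h2, h1]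

theorem rank_le_rank_tuple {l : ℕ} (v : Fin l → ZFSet.{u}) (i : Fin l) :
    rank (v i) ≤ rank (tuple l v) := by
  induction l with
  | zero => exact i.elim0
  | succ l ih =>
    induction i using Fin.lastCases with
    | last => exact rank_left_le_rank_pair _ _
    | cast i => exact (ih (Fin.init v) i).trans (rank_right_le_rank_pair _ _)

theorem tuple_mem_vonNeumann {β : Ordinal.{u}} (hβ : IsSuccLimit β) {l : ℕ}
    (v : Fin l → ZFSet.{u}) (h : ∀ i, v i ∈ V_ β) : tuple l v ∈ V_ β := by
  induction l with
  | zero => exact empty_mem_vonNeumann hβ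
  | succ l ih => exact (pair_mem_vonNeumann hβ).2 ⟨h _, ih _ fun i => h _⟩

theorem tuple_snoc {l : ℕ} (v : Fin l → ZFSet.{u}) (a : ZFSet.{u}) :
    tuple (l + 1) (Fin.snoc v a) = pair a (tuple l v) := by
  simp [tuple, Fin.init_snoc]

theorem term_eq_var {k l : ℕ} (t : (setLang k).Term (Empty ⊕ Fin l)) :
    ∃ i, t = Term.var (Sum.inr i) := by
  cases t with
  | var x =>
    cases x with
    | inl e => exact e.elim
    | inr i => exact ⟨i, rfl⟩
  | func f _ => exact f.elim

/-- Truth of a first-order formula in `(V_β, ∈, X)`. -/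
def Truth (β : Ordinal.{u}) {k l : ℕ} (ψ : (setLang k).BoundedFormula Empty l)
    (X : Fin k → Set ZFSet.{u}) (v : Fin l → {x : ZFSet.{u} // x ∈ V_ β}) : Prop :=
  @BoundedFormula.Realize _ _ (setStructure β (restrict β X)) _ _ ψ default v

/-- `G β X F` is a truth definition for `ψ`: a condition on `F`, expressed by a local matrix, that
can always be satisfied, and any `F` satisfying it contains, as its left component, the codes of
the tuples that satisfy `ψ`. -/
structure IsTruthDefinition {k l : ℕ} (ψ : (setLang k).BoundedFormula Empty l)
    (G : Ordinal.{u} → (Fin k → Set ZFSet.{u}) → Set ZFSet.{u} → Prop) : Prop where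
  localPi : ∀ (σ : Fin k → Set ZFSet.{u} → Set ZFSet.{u}) (τ : Set ZFSet.{u} → Set ZFSet.{u}),
    (∀ i, BoundedModulus (σ i)) → BoundedModulus τ →
    LocalPi 0 fun β J => G β (fun i => σ i J) (τ J)
  exists_sat : ∀ β, IsSuccLimit β → ∀ X, ∃ F, G β X F
  mem_iff : ∀ β, IsSuccLimit β → ∀ X F, G β X F → ∀ v : Fin l → {x : ZFSet.{u} // x ∈ V_ β},
    tuple l (fun i => (v i).1) ∈ left F ↔ Truth β ψ X v

/-- A formula whose truth at a tuple is a local condition on the code of the tuple has a truth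
definition; this covers the atomic formulas. -/
theorem IsTruthDefinition.of_isLocal {k l : ℕ} (ψ : (setLang k).BoundedFormula Empty l)
    (D : ZFSet.{u} → (Fin k → Set ZFSet.{u}) → Prop)
    (hD : ∀ σ : Fin k → Set ZFSet.{u} → Set ZFSet.{u}, (∀ i, BoundedModulus (σ i)) →
      IsLocal (fun c (_ : ZFSet.{u}) J => D c (fun i => σ i J)))
    (h : ∀ β, IsSuccLimit β → ∀ X, ∀ v : Fin l → {x : ZFSet.{u} // x ∈ V_ β},
      D (tuple l (fun i => (v i).1)) X ↔ Truth β ψ X v) :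
    IsTruthDefinition ψ (fun β X F => ∀ c ∈ V_ β, (c ∈ left F ↔ D c X)) where
  localPi σ τ hσ hτ := IsLocal.localPi_zero_forall
    (Δ := fun c _ J => c ∈ left (τ J) ↔ D c (fun i => σ i J))
    ((IsLocal.mem_left.comp (BoundedModulus.left.comp hτ)).iff (hD σ hσ))
  exists_sat β hβ X := ⟨join {c | D c X} ∅, fun c _ => by simp⟩
  mem_iff β hβ X F hF v :=
    (hF _ (tuple_mem_vonNeumann hβ _ fun i => (v i).2)).trans (h β hβ X v)

/-- `F` joins the class of tuples for the implication with the join of the truth data for the two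
subformulas. -/
theorem IsTruthDefinition.imp {k l : ℕ} {ψ₁ ψ₂ : (setLang k).BoundedFormula Empty l}
    {G₁ G₂ : Ordinal.{u} → (Fin k → Set ZFSet.{u}) → Set ZFSet.{u} → Prop}
    (h₁ : IsTruthDefinition ψ₁ G₁) (h₂ : IsTruthDefinition ψ₂ G₂) :
    IsTruthDefinition (ψ₁.imp ψ₂) (fun β X F => (G₁ β X (left (right F)) ∧
      G₂ β X (right (right F))) ∧ ∀ c ∈ V_ β,
        (c ∈ left F ↔ (c ∈ left (left (right F)) → c ∈ left (right (right F))))) where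
  localPi σ τ hσ hτ := by
    have hr := BoundedModulus.right.comp hτ
    refine ((h₁.localPi σ _ hσ (BoundedModulus.left.comp hr)).and
      (h₂.localPi σ _ hσ (BoundedModulus.right.comp hr))).and ?_
    refine IsLocal.localPi_zero_forall (Δ := fun c _ J => c ∈ left (τ J) ↔
      (c ∈ left (left (right (τ J))) → c ∈ left (right (right (τ J))))) ?_
    exact (IsLocal.mem_left.comp (BoundedModulus.left.comp hτ)).iff
      ((IsLocal.mem_left.comp (BoundedModulus.left.comp (BoundedModulus.left.comp hr))).imp
        (IsLocal.mem_left.comp (BoundedModulus.left.comp (BoundedModulus.right.comp hr))))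
  exists_sat β hβ X := by
    obtain ⟨F₁, hF₁⟩ := h₁.exists_sat β hβ X
    obtain ⟨F₂, hF₂⟩ := h₂.exists_sat β hβ X
    exact ⟨join {c | c ∈ left F₁ → c ∈ left F₂} (join F₁ F₂), by simp [hF₁, hF₂]⟩
  mem_iff β hβ X F hF v := by
    obtain ⟨⟨hF₁, hF₂⟩, hF⟩ := hF
    rw [hF _ (tuple_mem_vonNeumann hβ _ fun i => (v i).2), h₁.mem_iff β hβ X _ hF₁,
      h₂.mem_iff β hβ X _ hF₂]
    rfl

/-- The Tarski clause for `∀` is split into its two implications, one of which has an existential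
matrix. `F` joins the class of tuples for `ψ.all` with the truth data for `ψ`. -/
theorem IsTruthDefinition.all {k l : ℕ} {ψ : (setLang k).BoundedFormula Empty (l + 1)}
    {G : Ordinal.{u} → (Fin k → Set ZFSet.{u}) → Set ZFSet.{u} → Prop}
    (h : IsTruthDefinition ψ G) :
    IsTruthDefinition ψ.all (fun β X F => G β X (right F) ∧ (∀ c ∈ V_ β,
      ∃ y ∈ V_ β, ((pair y c ∈ left (right F) → c ∈ left F))) ∧
        ∀ c ∈ V_ β, ¬ ∃ y a, c = pair y a ∧ (pair y a ∉ left (right F) ∧ a ∈ left F)) where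
  localPi σ τ hσ hτ := by
    have hr := BoundedModulus.right.comp hτ
    have hp : IsLocal (fun c y J => pair y c ∈ left (right (τ J))) := by
      obtain ⟨k, hk⟩ := IsLocal.mem_left.comp (BoundedModulus.left.comp hr)
      refine ⟨2 + k, fun c y J J' hJ => hk (pair y c) (pair y c) J J' (hJ.mono ?_)⟩
      rw [max_self, rank_pair_eq, max_comm, Nat.cast_add, ← add_assoc]
      rfl
    have hc := IsLocal.mem_left.comp (BoundedModulus.left.comp hτ)
    refine (h.localPi σ _ hσ hr).and ((hp.imp hc).localPi_zero.and ?_)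
    refine IsLocal.localPi_zero_forall (Δ := fun c _ J => ¬ ∃ y a, c = pair y a ∧
      (pair y a ∉ left (right (τ J)) ∧ a ∈ left (τ J))) ?_
    have hq : IsLocal (fun y a J => pair y a ∉ left (right (τ J)) ∧ a ∈ left (τ J)) := by
      refine IsLocal.and (IsLocal.not ?_)
        (IsLocal.mem_right.comp (BoundedModulus.left.comp hτ))
      obtain ⟨k, hk⟩ := hp
      exact ⟨k, fun c y J J' hJ => hk y c J J' (by rwa [max_comm])⟩
    refine (hq.exists (fun c _ y a => c = pair y a) 0 ?_).not
    rintro _ y a b rfl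
    rw [Nat.cast_zero, add_zero]
    exact le_max_of_le_left (max_le (rank_left_le_rank_pair a b) (rank_right_le_rank_pair a b))
  exists_sat β hβ X := by
    obtain ⟨F, hF⟩ := h.exists_sat β hβ X
    refine ⟨join {c | ∀ y ∈ V_ β, pair y c ∈ left F} F, by simpa using hF, ?_, ?_⟩
    · intro c hc
      by_cases hn : ∃ y ∈ V_ β, pair y c ∉ left F
      · obtain ⟨y, hy, hyc⟩ := hn
        exact ⟨y, hy, fun h => (hyc (by simpa using h)).elim⟩
      · push Not at hn
        exact ⟨c, hc, fun _ => by simpa using hn⟩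
    · rintro _ hp ⟨y, a, rfl, hn, ha⟩
      simp only [left_join, right_join] at hn ha
      exact hn (ha y ((pair_mem_vonNeumann hβ).1 hp).1)
  mem_iff β hβ X F hF v := by
    obtain ⟨hG, h1, h2⟩ := hF
    have hv := tuple_mem_vonNeumann hβ _ fun i => (v i).2
    have key : ∀ a : {x : ZFSet.{u} // x ∈ V_ β}, pair a.1 (tuple l fun i => (v i).1) ∈
        left (right F) ↔ Truth β ψ X (Fin.snoc v a) := by
      intro a
      rw [← h.mem_iff β hβ X _ hG, ← tuple_snoc]
      congr! 2
      ext i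
      induction i using Fin.lastCases <;> simp
    have hall : Truth β ψ.all X v ↔ ∀ a, Truth β ψ X (Fin.snoc v a) := Iff.rfl
    rw [hall]
    constructor
    · intro hv' a
      by_contra hn
      rw [← key] at hn
      exact h2 _ ((pair_mem_vonNeumann hβ).2 ⟨a.2, hv⟩) ⟨_, _, rfl, hn, hv'⟩
    · intro ha
      obtain ⟨y, hy, hyv⟩ := h1 _ hv
      exact hyv ((key ⟨y, hy⟩).2 (ha _))

theorem exists_isTruthDefinition {k l : ℕ} (ψ : (setLang k).BoundedFormula Empty l) :
    ∃ G : Ordinal.{u} → (Fin k → Set ZFSet.{u}) → Set ZFSet.{u} → Prop,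
      IsTruthDefinition ψ G := by
  induction ψ with
  | falsum =>
    exact ⟨_, .of_isLocal _ (fun _ _ => False) (fun _ _ => .const _) fun _ _ _ _ => Iff.rfl⟩
  | @equal l t₁ t₂ =>
    obtain ⟨i, rfl⟩ := term_eq_var t₁
    obtain ⟨j, rfl⟩ := term_eq_var t₂
    refine ⟨_, .of_isLocal _ (fun c _ => ∃ w, c = tuple l w ∧ w i = w j)
      (fun _ _ => .const fun c _ => _) fun β _ X v => ?_⟩
    refine Iff.trans ?_ (Subtype.ext_iff (a1 := v i) (a2 := v j)).symm
    exact ⟨fun ⟨w, hw, h⟩ => by obtain rfl := tuple_injective _ hw; exact h,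
      fun h => ⟨_, rfl, h⟩⟩
  | @rel l m R ts =>
    cases R with
    | mem =>
      obtain ⟨i, hi⟩ := term_eq_var (ts 0)
      obtain ⟨j, hj⟩ := term_eq_var (ts 1)
      refine ⟨_, .of_isLocal _ (fun c _ => ∃ w, c = tuple l w ∧ w i ∈ w j)
        (fun _ _ => .const fun c _ => _) fun β _ X v => ?_⟩
      have : Truth β (.rel SetRel.mem ts) X v ↔ (v i).1 ∈ (v j).1 := by
        let := setStructure β (restrict β X)
        change ((ts 0).realize (Sum.elim default v)).1 ∈
          ((ts 1).realize (Sum.elim default v)).1 ↔ _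
        rw [hi, hj]
        rfl
      rw [this]
      exact ⟨fun ⟨w, hw, h⟩ => by obtain rfl := tuple_injective _ hw; exact h,
        fun h => ⟨_, rfl, h⟩⟩
    | pred p =>
      obtain ⟨i, hi⟩ := term_eq_var (ts 0)
      refine ⟨_, .of_isLocal _ (fun c X => ∃ a b, (∃ w, c = tuple l w ∧ a = w i ∧ b = w i) ∧
        a ∈ X p) (fun σ hσ => (IsLocal.mem_left.comp (hσ p)).exists
          (fun c _ a b => ∃ w, c = tuple l w ∧ a = w i ∧ b = w i) 0 ?_) fun β _ X v => ?_⟩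
      · rintro _ y _ _ ⟨w, rfl, rfl, rfl⟩
        rw [Nat.cast_zero, add_zero, max_self]
        exact le_max_of_le_left (rank_le_rank_tuple w i)
      · have : Truth β (.rel (SetRel.pred p) ts) X v ↔ (v i).1 ∈ X p := by
          let := setStructure β (restrict β X)
          change ((ts 0).realize (Sum.elim default v)).1 ∈ restrict β X p ↔ _
          rw [hi, restrict, ZFSet.mem_sep]
          exact and_iff_right (v i).2
        rw [this]
        constructor
        · rintro ⟨_, _, ⟨w, hw, rfl, rfl⟩, h⟩
          obtain rfl := tuple_injective _ hw
          exact h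
        · exact fun h => ⟨_, _, ⟨_, rfl, rfl, rfl⟩, h⟩
  | imp ψ₁ ψ₂ ih₁ ih₂ =>
    obtain ⟨G₁, h₁⟩ := ih₁
    obtain ⟨G₂, h₂⟩ := ih₂
    exact ⟨_, IsTruthDefinition.imp h₁ h₂⟩
  | all ψ ih =>
    obtain ⟨G, h⟩ := ih
    exact ⟨_, IsTruthDefinition.all h⟩

/-- First-order truth of a sentence in `(V_β, ∈, X)`. -/
def SentenceTruth (β : Ordinal.{u}) {k : ℕ} (ψ : (setLang k).Sentence)
    (X : Fin k → Set ZFSet.{u}) : Prop :=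
  @Sentence.Realize _ {x : ZFSet.{u} // x ∈ V_ β} (setStructure β (restrict β X)) ψ

/-- First-order truth is "there are truth data according to which the sentence is true". -/
theorem exists_truth_data {k : ℕ} (ψ : (setLang k).Sentence) :
    ∃ G : Ordinal.{u} → (Fin k → Set ZFSet.{u}) → Set ZFSet.{u} → Prop,
      (∀ (σ : Fin k → Set ZFSet.{u} → Set ZFSet.{u}) (τ : Set ZFSet.{u} → Set ZFSet.{u}),
        (∀ i, BoundedModulus (σ i)) → BoundedModulus τ →
        LocalPi 0 fun β J => G β (fun i => σ i J) (τ J)) ∧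
      ∀ β, IsSuccLimit β → ∀ X, SentenceTruth β ψ X ↔ ∃ F, G β X F := by
  obtain ⟨G, hG⟩ := exists_isTruthDefinition.{u} ψ
  have hmem : ∀ β, IsSuccLimit β → ∀ X F, G β X F → (∅ ∈ left F ↔ SentenceTruth β ψ X) := by
    intro β hβ X F hF
    exact hG.mem_iff β hβ X F hF default
  refine ⟨fun β X F => G β X F ∧ ∃ y ∈ V_ β, y = ∅ ∧ y ∈ left F, fun σ τ hσ hτ => ?_,
    fun β hβ X => ?_⟩
  · refine (hG.localPi σ τ hσ hτ).and (IsLocal.localPi_zero_exists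
      (Δ := fun _ y J => y = ∅ ∧ y ∈ left (τ J)) ?_)
    exact (IsLocal.const fun _ y => y = ∅).and
      (IsLocal.mem_right.comp (BoundedModulus.left.comp hτ))
  · constructor
    · intro h
      obtain ⟨F, hF⟩ := hG.exists_sat β hβ X
      exact ⟨F, hF, ∅, empty_mem_vonNeumann hβ, rfl, (hmem β hβ X F hF).2 h⟩
    · rintro ⟨F, hF, y, _, rfl, h⟩
      exact (hmem β hβ X F hF).1 h

theorem localPi_one_not_sentenceTruth {k : ℕ} (ψ : (setLang k).Sentence)
    (σ : Fin k → Set ZFSet.{u} → Set ZFSet.{u}) (hσ : ∀ i, BoundedModulus (σ i)) :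
    LocalPi 1 fun β J => ¬ SentenceTruth β ψ (fun i => σ i J) := by
  obtain ⟨G, hG, h⟩ := exists_truth_data.{u} ψ
  refine (hG (fun i J => σ i (left J)) right (fun i => (hσ i).comp .left)
    .right).forall_not.congr fun β hβ J => ?_
  simp [h β hβ]

theorem sentenceTruth_not {β : Ordinal.{u}} {k : ℕ} (ψ : (setLang k).Sentence)
    (X : Fin k → Set ZFSet.{u}) : SentenceTruth β ψ.not X ↔ ¬ SentenceTruth β ψ X :=
  Iff.rfl

theorem localPi_one_sentenceTruth {k : ℕ} (ψ : (setLang k).Sentence)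
    (σ : Fin k → Set ZFSet.{u} → Set ZFSet.{u}) (hσ : ∀ i, BoundedModulus (σ i)) :
    LocalPi 1 fun β J => SentenceTruth β ψ (fun i => σ i J) := by
  simpa only [sentenceTruth_not, not_not] using localPi_one_not_sentenceTruth ψ.not σ hσ

/-! ### Second-order formulas are local -/

theorem restrict_append (β : Ordinal.{u}) {k m : ℕ} (X : Fin k → Set ZFSet.{u})
    (Y : Fin m → Set ZFSet.{u}) :
    restrict β (Fin.append X Y) = Fin.append (restrict β X) (restrict β Y) := by
  ext i
  induction i using Fin.addCases <;> simp [restrict]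

/-- The components of a class that codes `m` classes. -/
def components (m : ℕ) (J : Set ZFSet.{u}) : Fin m → Set ZFSet.{u} :=
  fun i => part ((i : ℕ) : Ordinal.{u}).toZFSet J

theorem exists_restrict_components_eq (β : Ordinal.{u}) {m : ℕ} (Y : Fin m → ZFSet.{u})
    (hY : ∀ i, Y i ⊆ V_ β) : ∃ J, restrict β (components m J) = Y := by
  refine ⟨{z | ∃ (i : Fin m) (y : ZFSet), y ∈ Y i ∧
    z = pair ((i : ℕ) : Ordinal.{u}).toZFSet y}, ?_⟩
  funext i
  ext y
  have : y ∈ components m {z | ∃ (i : Fin m) (y : ZFSet), y ∈ Y i ∧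
      z = pair ((i : ℕ) : Ordinal.{u}).toZFSet y} i ↔ y ∈ Y i := by
    constructor
    · rintro ⟨j, y', hy', h⟩
      obtain ⟨h1, rfl⟩ := pair_inj.1 h
      have := Fin.ext (Nat.cast_injective (Ordinal.toZFSet_injective h1))
      rwa [this]
    · exact fun h => ⟨i, y, h, rfl⟩
  rw [restrict, ZFSet.mem_sep, this]
  exact and_iff_right_of_imp fun h => hY i h

theorem restrict_subset (β : Ordinal.{u}) {k : ℕ} (X : Fin k → Set ZFSet.{u}) (i : Fin k) :
    restrict β X i ⊆ V_ β := ZFSet.sep_subset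

theorem holds_all_iff {β : Ordinal.{u}} {n k m : ℕ} (φ : SOFormula .sigma n (k + m))
    (X : Fin k → Set ZFSet.{u}) : (SOFormula.all m φ).Holds β (restrict β X) ↔
      ∀ Y, φ.Holds β (restrict β (Fin.append X (components m Y))) := by
  simp only [SOFormula.Holds, restrict_append]
  constructor
  · exact fun h Y => h _ (restrict_subset β _)
  · intro h Y hY
    obtain ⟨J, rfl⟩ := exists_restrict_components_eq β Y hY
    exact h J

theorem holds_ex_iff {β : Ordinal.{u}} {n k m : ℕ} (φ : SOFormula .pi n (k + m))
    (X : Fin k → Set ZFSet.{u}) : (SOFormula.ex m φ).Holds β (restrict β X) ↔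
      ∃ Y, φ.Holds β (restrict β (Fin.append X (components m Y))) := by
  simp only [SOFormula.Holds, restrict_append]
  constructor
  · rintro ⟨Y, hY, h⟩
    obtain ⟨J, rfl⟩ := exists_restrict_components_eq β Y hY
    exact ⟨J, h⟩
  · rintro ⟨Y, h⟩
    exact ⟨_, restrict_subset β _, h⟩

theorem append_components_eq {k m : ℕ} (σ : Fin k → Set ZFSet.{u} → Set ZFSet.{u})
    (J Y : Set ZFSet.{u}) :
    (fun i => (Fin.append (fun i J => σ i (left J)) (fun (i : Fin m) J =>
      components m (right J) i) : Fin (k + m) → Set ZFSet.{u} → Set ZFSet.{u}) i (join J Y)) =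
      Fin.append (fun i => σ i J) (components m Y) := by
  funext i
  induction i using Fin.addCases <;> simp

theorem boundedModulus_append {k m : ℕ} {σ : Fin k → Set ZFSet.{u} → Set ZFSet.{u}}
    (hσ : ∀ i, BoundedModulus (σ i)) (i : Fin (k + m)) :
    BoundedModulus ((Fin.append (fun i J => σ i (left J)) (fun (i : Fin m) J =>
      components m (right J) i) : Fin (k + m) → Set ZFSet.{u} → Set ZFSet.{u}) i) := by
  induction i using Fin.addCases with
  | left i => simpa using (hσ i).comp .left
  | right i => simpa [components] using (BoundedModulus.part_natCast i).comp .right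

/-- For `n ≥ 1`, truth of a `Π¹ₙ`-formula and falsity of a `Σ¹ₙ`-formula are local
`Π¹ₙ`-properties. -/
theorem localPi_holds (n : ℕ) :
    (∀ {k : ℕ} (φ : SOFormula .pi (n + 1) k) (σ : Fin k → Set ZFSet.{u} → Set ZFSet.{u}),
      (∀ i, BoundedModulus (σ i)) →
        LocalPi (n + 1) fun β J => φ.Holds β (restrict β fun i => σ i J)) ∧
    (∀ {k : ℕ} (φ : SOFormula .sigma (n + 1) k) (σ : Fin k → Set ZFSet.{u} → Set ZFSet.{u}),
      (∀ i, BoundedModulus (σ i)) →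
        LocalPi (n + 1) fun β J => ¬ φ.Holds β (restrict β fun i => σ i J)) := by
  induction n with
  | zero =>
    constructor
    · rintro k (_ | ⟨m, ⟨ψ⟩⟩) σ hσ
      refine (localPi_one_sentenceTruth ψ _ (boundedModulus_append (m := m) hσ)).forall.congr
        fun β hβ J => ?_
      rw [holds_all_iff]
      simp only [append_components_eq]
      rfl
    · rintro k (_ | _ | ⟨m, ⟨ψ⟩⟩) σ hσ
      refine (localPi_one_not_sentenceTruth ψ _ (boundedModulus_append (m := m) hσ)).forall.congr
        fun β hβ J => ?_
      rw [holds_ex_iff, not_exists]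
      simp only [append_components_eq]
      rfl
  | succ n ih =>
    constructor
    · rintro k (_ | ⟨m, φ⟩) σ hσ
      refine (ih.2 φ _ (boundedModulus_append (m := m) hσ)).forall_not.congr fun β hβ J => ?_
      rw [holds_all_iff]
      simp only [append_components_eq, not_not]
    · rintro k (_ | _ | ⟨m, φ⟩) σ hσ
      refine (ih.1 φ _ (boundedModulus_append (m := m) hσ)).forall_not.congr fun β hβ J => ?_
      rw [holds_ex_iff, not_exists]
      simp only [append_components_eq]

/-! ### Universal local properties -/

theorem normalForm_congr {β : Ordinal.{u}} {R : ZFSet.{u} → ZFSet.{u} → ZFSet.{u} → Prop} {n : ℕ}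
    {J J' : Set ZFSet.{u}} (h : ∀ x ∈ V_ β, x ∈ J ↔ x ∈ J') :
    NormalForm β R n J ↔ NormalForm β R n J' := by
  induction n generalizing J J' with
  | zero =>
    refine forall₂_congr fun c _ => exists_congr fun d => and_congr_right fun hd => ?_
    have : d.sep (· ∈ J) = d.sep (· ∈ J') := by
      ext x
      simp only [ZFSet.mem_sep]
      exact and_congr_right fun hx => h x (isTransitive_vonNeumann β _ hd hx)
    rw [this]
  | succ n ih =>
    refine forall_congr' fun Y => not_congr (ih fun z hz => or_congr_left ?_)
    refine exists_congr fun x => and_congr_left ?_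
    rintro rfl
    refine h x (mem_vonNeumann.2 ((rank_right_le_rank_pair _ _).trans_lt (mem_vonNeumann.1 hz)))

theorem LocalPi.iff_of_agree {n : ℕ} {P : Ordinal.{u} → Set ZFSet.{u} → Prop} (hP : LocalPi n P)
    {β : Ordinal.{u}} (hβ : IsSuccLimit β) {J J' : Set ZFSet.{u}}
    (h : ∀ x ∈ V_ β, x ∈ J ↔ x ∈ J') : P β J ↔ P β J' := by
  obtain ⟨R, hR⟩ := hP
  rw [hR β hβ, hR β hβ, normalForm_congr h]

/-- The ternary relation that is coded by a class of triples. -/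
def codedRel (S : Set ZFSet.{u}) (c d j : ZFSet.{u}) : Prop := pair c (pair d j) ∈ S

/-- The universal local `Π¹ₙ`-property: `W` codes both a class, its left component, and the relation
of a normal form, its right component. -/
def Universal (n : ℕ) (β : Ordinal.{u}) (W : Set ZFSet.{u}) : Prop :=
  NormalForm β (codedRel (right W)) n (left W)

theorem localPi_normalForm_codedRel (n : ℕ) {σ τ : Set ZFSet.{u} → Set ZFSet.{u}}
    (hσ : BoundedModulus σ) (hτ : BoundedModulus τ) :
    LocalPi n fun β J => NormalForm β (codedRel (τ J)) n (σ J) := by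
  induction n generalizing σ τ with
  | zero =>
    refine IsLocal.localPi_zero (Δ := fun c d J => pair c (pair d (d.sep (· ∈ σ J))) ∈ τ J) ?_
    obtain ⟨k, hk⟩ := hσ
    obtain ⟨l, hl⟩ := hτ
    refine ⟨4 + l + k, fun c d J J' h hJ => ?_⟩
    have h1 : d.sep (· ∈ σ J) = d.sep (· ∈ σ J') := by
      refine sep_eq_sep (BoundedModulus.agreeUpTo hk (h.mono ?_)) le_rfl
      exact add_le_add (le_max_right _ _) (by simp)
    beta_reduce at hJ ⊢
    rw [← h1]
    refine (hl _ J J' (h.mono ?_)).1 hJ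
    have h2 : rank (pair c (pair d (d.sep (· ∈ σ J)))) ≤ max (rank c) (rank d) + (4 : ℕ) := by
      have h3 : rank (d.sep (· ∈ σ J)) ≤ rank d := rank_mono ZFSet.sep_subset
      rw [rank_pair_eq, rank_pair_eq, max_eq_left h3]
      have h4 : max (rank c) (rank d + 2) ≤ max (rank c) (rank d) + 2 :=
        max_le ((le_max_left _ _).trans le_self_add) (by gcongr; exact le_max_right _ _)
      calc _ ≤ max (rank c) (rank d) + 2 + 2 := by gcongr
        _ = _ := by rw [add_assoc]; norm_num
    calc _ ≤ max (rank c) (rank d) + (4 : ℕ) + l := by gcongr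
      _ ≤ _ := by rw [add_assoc]; gcongr; simp
  | succ n ih =>
    refine (ih (hσ := (hσ.comp .left).join .right) (hτ := hτ.comp .left)).forall_not.congr
      fun β hβ J => ?_
    simp [NormalForm]

theorem localPi_universal (n : ℕ) : LocalPi n (Universal.{u} n) :=
  localPi_normalForm_codedRel n .left .right

/-- A local `Π¹ₙ`-property of a fixed class is an instance of the universal one. -/
theorem LocalPi.exists_universal {n : ℕ} {P : Ordinal.{u} → Set ZFSet.{u} → Prop}
    (hP : LocalPi n P) (J : Set ZFSet.{u}) :
    ∃ W, ∀ β, IsSuccLimit β → (P β J ↔ Universal n β W) := by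
  obtain ⟨R, hR⟩ := hP
  refine ⟨join J {z | ∃ c d j, R c d j ∧ z = pair c (pair d j)}, fun β hβ => ?_⟩
  have : codedRel (right (join J {z | ∃ c d j, R c d j ∧ z = pair c (pair d j)})) = R := by
    ext c d j
    rw [right_join]
    constructor
    · rintro ⟨c', d', j', h, h'⟩
      rw [pair_inj, pair_inj] at h'
      obtain ⟨rfl, rfl, rfl⟩ := h'
      exact h
    · exact fun h => ⟨c, d, j, h, rfl⟩
  rw [Universal, this, left_join]
  exact hR β hβ J

/-! ### First-order definability -/

/-- The assignment that sends variable `0` to `x` and shifts the others. -/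
def push {M : Type*} (x : M) (v : ℕ → M) : ℕ → M
  | 0 => x
  | i + 1 => v i

/-- `P` is uniformly first-order definable over the structures `(V_β, ∈, X)` with `β` limit. The
free variables are indexed by `ℕ`. -/
def FODefinable {k : ℕ} (P : Ordinal.{u} → (Fin k → ZFSet.{u}) → (ℕ → ZFSet.{u}) → Prop) : Prop :=
  ∃ ψ : (setLang k).Formula ℕ, ∀ β, IsSuccLimit β → ∀ X (v : ℕ → {x : ZFSet.{u} // x ∈ V_ β}),
    @Formula.Realize _ _ (setStructure β X) _ ψ v ↔ P β X (fun i => (v i).1)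

namespace FODefinable

variable {k : ℕ} {P Q : Ordinal.{u} → (Fin k → ZFSet.{u}) → (ℕ → ZFSet.{u}) → Prop}

theorem congr (hP : FODefinable P)
    (h : ∀ β, IsSuccLimit β → ∀ X v, (∀ i, v i ∈ V_ β) → (Q β X v ↔ P β X v)) :
    FODefinable Q := by
  obtain ⟨ψ, hψ⟩ := hP
  exact ⟨ψ, fun β hβ X v => (hψ β hβ X v).trans (h β hβ X _ fun i => (v i).2).symm⟩

theorem mem (i j : ℕ) : FODefinable (k := k) (fun (_ : Ordinal.{u}) _ v => v i ∈ v j) :=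
  ⟨Relations.formula₂ (L := setLang k) (SetRel.mem : SetRel k 2) (Term.var i) (Term.var j),
    fun _ _ _ _ => Iff.rfl⟩

theorem pred (p : Fin k) (i : ℕ) : FODefinable (fun (_ : Ordinal.{u}) X v => v i ∈ X p) :=
  ⟨Relations.formula₁ (L := setLang k) (SetRel.pred p : SetRel k 1) (Term.var i),
    fun _ _ _ _ => Iff.rfl⟩

theorem false : FODefinable (k := k) (fun (_ : Ordinal.{u}) _ _ => False) :=
  ⟨⊥, fun _ _ _ _ => Iff.rfl⟩

theorem imp (hP : FODefinable P) (hQ : FODefinable Q) :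
    FODefinable (fun β X v => P β X v → Q β X v) := by
  obtain ⟨ψ, hψ⟩ := hP
  obtain ⟨χ, hχ⟩ := hQ
  exact ⟨ψ.imp χ, fun β hβ X v => imp_congr (hψ β hβ X v) (hχ β hβ X v)⟩

theorem not (hP : FODefinable P) : FODefinable (fun β X v => ¬ P β X v) := hP.imp .false

theorem and (hP : FODefinable P) (hQ : FODefinable Q) :
    FODefinable (fun β X v => P β X v ∧ Q β X v) := by
  simpa only [Classical.not_imp, not_not] using (hP.imp hQ.not).not

theorem or (hP : FODefinable P) (hQ : FODefinable Q) :
    FODefinable (fun β X v => P β X v ∨ Q β X v) := by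
  simpa only [or_iff_not_imp_left] using hP.not.imp hQ

theorem iff (hP : FODefinable P) (hQ : FODefinable Q) :
    FODefinable (fun β X v => P β X v ↔ Q β X v) := by
  simpa only [iff_def] using (hP.imp hQ).and (hQ.imp hP)

theorem all (hP : FODefinable P) :
    FODefinable (fun β X v => ∀ x ∈ V_ β, P β X (push x v)) := by
  obtain ⟨ψ, hψ⟩ := hP
  refine ⟨(BoundedFormula.relabel (n := 1) (k := 0)
    (fun i => push (Sum.inr 0) Sum.inl i : ℕ → ℕ ⊕ Fin 1) ψ).all, fun β hβ X v => ?_⟩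
  let := setStructure β X
  have key : ∀ a : {x : ZFSet.{u} // x ∈ V_ β}, (BoundedFormula.relabel (n := 1) (k := 0)
      (fun i => push (Sum.inr 0) Sum.inl i : ℕ → ℕ ⊕ Fin 1) ψ).Realize v
        (Fin.snoc default a) ↔ P β X (push a.1 fun i => (v i).1) := by
    intro a
    rw [BoundedFormula.realize_relabel]
    have h1 : (fun i => (push a v i).1) = push a.1 fun i => (v i).1 := by
      funext i; cases i <;> rfl
    rw [← h1, ← hψ β hβ X (push a v), Formula.Realize]
    refine iff_of_eq ?_
    congr 1
    · funext i; cases i <;> rfl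
    · exact Subsingleton.elim _ _
  exact ⟨fun h x hx => (key ⟨x, hx⟩).1 (h _), fun h a => (key a).2 (h a.1 a.2)⟩

theorem ex (hP : FODefinable P) :
    FODefinable (fun β X v => ∃ x ∈ V_ β, P β X (push x v)) := by
  simpa only [not_forall, not_not, exists_prop] using hP.not.all.not

theorem eq_unordered_pair (i a b : ℕ) :
    FODefinable (k := k) (fun (_ : Ordinal.{u}) _ v => v i = {v a, v b}) := by
  have heq : ∀ i j : ℕ, FODefinable (k := k) (fun (_ : Ordinal.{u}) _ v => v i = v j) := by
    intro i j
    refine ((mem 0 (i + 1)).iff (mem 0 (j + 1))).all.congr fun β _ X v hv => ?_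
    rw [ZFSet.ext_iff]
    exact ⟨fun h x _ => h x, fun h x =>
      ⟨fun hx => (h x (isTransitive_vonNeumann β _ (hv i) hx)).1 hx,
      fun hx => (h x (isTransitive_vonNeumann β _ (hv j) hx)).2 hx⟩⟩
  refine ((mem 0 (i + 1)).iff ((heq 0 (a + 1)).or (heq 0 (b + 1)))).all.congr
    fun β _ X v hv => ?_
  rw [ZFSet.ext_iff]
  simp only [ZFSet.mem_pair]
  refine ⟨fun h x _ => h x, fun h x => ⟨fun hx => ?_, fun hx => ?_⟩⟩
  · exact (h x (isTransitive_vonNeumann β _ (hv i) hx)).1 hx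
  · have : x ∈ V_ β := by rcases hx with rfl | rfl <;> exact hv _
    exact (h x this).2 hx

theorem eq_pair (i a b : ℕ) :
    FODefinable (k := k) (fun (_ : Ordinal.{u}) _ v => v i = pair (v a) (v b)) := by
  refine (((eq_unordered_pair 0 (a + 2) (a + 2)).and (eq_unordered_pair 1 (a + 2) (b + 2))).and
    (eq_unordered_pair (i + 2) 0 1)).ex.ex.congr fun β hβ X v hv => ?_
  simp only [push]
  constructor
  · intro h
    have h1 : v i ⊆ V_ β := (isTransitive_vonNeumann β).subset_of_mem (hv i)
    refine ⟨{v a, v b}, h1 ?_, {v a, v a}, h1 ?_, ⟨rfl, rfl⟩, ?_⟩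
    · rw [h]; simp [pair]
    · rw [h]; simp [pair]
    · rw [h]; simp [pair]
  · rintro ⟨_, _, _, _, ⟨rfl, rfl⟩, h⟩
    rw [h]; simp [pair]

theorem eq_empty (i : ℕ) : FODefinable (k := k) (fun (_ : Ordinal.{u}) _ v => v i = ∅) := by
  refine (mem 0 (i + 1)).not.all.congr fun β _ X v hv => ?_
  rw [ZFSet.eq_empty]
  exact ⟨fun h x _ => h x, fun h x hx => h x (isTransitive_vonNeumann β _ (hv i) hx) hx⟩

theorem eq_singleton_empty (i : ℕ) :
    FODefinable (k := k) (fun (_ : Ordinal.{u}) _ v => v i = {∅}) := by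
  refine ((eq_empty 0).and (eq_unordered_pair (i + 1) 0 0)).ex.congr fun β hβ X v hv => ?_
  simp only [push]
  constructor
  · exact fun h => ⟨∅, empty_mem_vonNeumann hβ, rfl, by simp [h]⟩
  · rintro ⟨_, _, rfl, h⟩
    simpa using h

/-- A definable condition without free variables is defined by a sentence. -/
theorem exists_sentence {P : Ordinal.{u} → (Fin k → ZFSet.{u}) → Prop}
    (hP : FODefinable (fun β X _ => P β X)) : ∃ ψ : (setLang k).Sentence,
      ∀ β, IsSuccLimit β → ∀ X, @Sentence.Realize _ {x : ZFSet.{u} // x ∈ V_ β}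
        (setStructure β X) ψ ↔ P β X := by
  obtain ⟨ψ, hψ⟩ := hP
  refine ⟨(BoundedFormula.relabel (n := 1) (k := 0)
    (fun _ => Sum.inr 0 : ℕ → Empty ⊕ Fin 1) ψ).all, fun β hβ X => ?_⟩
  let := setStructure β X
  have key : ∀ a : {x : ZFSet.{u} // x ∈ V_ β}, (BoundedFormula.relabel (n := 1) (k := 0)
      (fun _ => Sum.inr 0 : ℕ → Empty ⊕ Fin 1) ψ).Realize default
        (Fin.snoc default a) ↔ P β X := by
    intro a
    refine Iff.trans ?_ (hψ β hβ X (fun _ => a))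
    rw [BoundedFormula.realize_relabel, Formula.Realize]
    refine iff_of_eq ?_
    congr 1
    exact Subsingleton.elim _ _
  exact ⟨fun h => (key ⟨∅, empty_mem_vonNeumann hβ⟩).1 (h _), fun h a => (key a).2 h⟩

end FODefinable

/-- A class term whose members are first-order definable from the predicates. -/
def DefinableClass {k : ℕ} (K : (Fin k → ZFSet.{u}) → Set ZFSet.{u}) : Prop :=
  ∀ i : ℕ, FODefinable (fun (_ : Ordinal.{u}) X v => v i ∈ K X)

theorem DefinableClass.left {k : ℕ} {K : (Fin k → ZFSet.{u}) → Set ZFSet.{u}}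
    (hK : DefinableClass K) : DefinableClass (fun X => left (K X)) := fun i => by
  refine (((FODefinable.eq_empty 0).and (.eq_pair 1 0 (i + 2))).and (hK 1)).ex.ex.congr
    fun β hβ X v hv => ?_
  simp only [push, mem_left]
  constructor
  · exact fun h => ⟨_, (pair_mem_vonNeumann hβ).2 ⟨empty_mem_vonNeumann hβ, hv i⟩, _,
      empty_mem_vonNeumann hβ, ⟨rfl, rfl⟩, h⟩
  · rintro ⟨_, _, _, _, ⟨rfl, rfl⟩, h⟩
    exact h

theorem DefinableClass.right {k : ℕ} {K : (Fin k → ZFSet.{u}) → Set ZFSet.{u}}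
    (hK : DefinableClass K) : DefinableClass (fun X => right (K X)) := fun i => by
  refine (((FODefinable.eq_singleton_empty 0).and (.eq_pair 1 0 (i + 2))).and (hK 1)).ex.ex.congr
    fun β hβ X v hv => ?_
  simp only [push, mem_right]
  constructor
  · exact fun h => ⟨_, (pair_mem_vonNeumann hβ).2 ⟨singleton_empty_mem_vonNeumann hβ, hv i⟩, _,
      singleton_empty_mem_vonNeumann hβ, ⟨rfl, rfl⟩, h⟩
  · rintro ⟨_, _, _, _, ⟨rfl, rfl⟩, h⟩
    exact h

theorem DefinableClass.join {k : ℕ} {K L : (Fin k → ZFSet.{u}) → Set ZFSet.{u}}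
    (hK : DefinableClass K) (hL : DefinableClass L) :
    DefinableClass (fun X => join (K X) (L X)) := fun i => by
  refine ((((FODefinable.eq_empty 0).and (.eq_pair (i + 2) 0 1)).and (hK 1)).ex.ex.or
    (((FODefinable.eq_singleton_empty 0).and (.eq_pair (i + 2) 0 1)).and (hL 1)).ex.ex).congr
    fun β hβ X v hv => ?_
  simp only [push]
  refine or_congr ?_ ?_
  · constructor
    · rintro ⟨x, hx, h⟩
      have hp := hv i
      rw [h, pair_mem_vonNeumann hβ] at hp
      exact ⟨x, hp.2, ∅, hp.1, ⟨rfl, h⟩, hx⟩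
    · rintro ⟨x, _, _, _, ⟨rfl, h⟩, hx⟩
      exact ⟨x, hx, h⟩
  · constructor
    · rintro ⟨x, hx, h⟩
      have hp := hv i
      rw [h, pair_mem_vonNeumann hβ] at hp
      exact ⟨x, hp.2, _, hp.1, ⟨rfl, h⟩, hx⟩
    · rintro ⟨x, _, _, _, ⟨rfl, h⟩, hx⟩
      exact ⟨x, hx, h⟩

theorem FODefinable.normalForm_zero {k : ℕ} {K S : (Fin k → ZFSet.{u}) → Set ZFSet.{u}}
    (hK : DefinableClass K) (hS : DefinableClass S) :
    FODefinable (fun β X _ => NormalForm β (codedRel (S X)) 0 (K X)) := by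
  have h := ((((FODefinable.mem (k := k) 0 1).iff ((FODefinable.mem 0 4).and (hK 0))).all.and
    ((FODefinable.eq_pair 1 3 0).and (.eq_pair 2 4 1))).and (hS 2)).ex.ex.ex.ex.all
  refine h.congr fun β hβ X v hv => ?_
  simp only [push, NormalForm, codedRel]
  refine forall₂_congr fun c hc => exists_congr fun d => and_congr_right fun hd => ?_
  constructor
  · intro h
    have hz := mem_vonNeumann_of_subset (ZFSet.sep_subset (p := (· ∈ K X))) hd
    have hp := (pair_mem_vonNeumann hβ).2 ⟨hd, hz⟩
    exact ⟨_, (pair_mem_vonNeumann hβ).2 ⟨hc, hp⟩, _, hp, _, hz,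
      ⟨fun x _ => ZFSet.mem_sep, rfl, rfl⟩, h⟩
  · rintro ⟨_, _, _, _, z, hz, ⟨h, rfl, rfl⟩, hS⟩
    have : z = d.sep (· ∈ K X) := by
      ext x
      rw [ZFSet.mem_sep]
      exact ⟨fun hx => (h x (isTransitive_vonNeumann β _ hz hx)).1 hx,
        fun hx => (h x (isTransitive_vonNeumann β _ hd hx.1)).2 hx⟩
    rwa [← this]

/-- A first-order sentence that holds in `(V_β, ∈)` exactly if `β` is a limit ordinal. -/
theorem exists_limit_sentence (k : ℕ) : ∃ ψ : (setLang k).Sentence,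
    ∀ (β : Ordinal.{u}) X, @Sentence.Realize _ {x : ZFSet.{u} // x ∈ V_ β}
      (setStructure β X) ψ ↔ IsSuccLimit β := by
  refine ⟨BoundedFormula.ex ⊤ ⊓ BoundedFormula.all (BoundedFormula.ex
    (Relations.boundedFormula₂ (L := setLang k) (SetRel.mem : SetRel k 2)
      (Term.var (Sum.inr 0)) (Term.var (Sum.inr 1)))), fun β X => ?_⟩
  let := setStructure β X
  have h : (Sentence.Realize {x : ZFSet.{u} // x ∈ V_ β} (BoundedFormula.ex ⊤ ⊓
      BoundedFormula.all (BoundedFormula.ex (Relations.boundedFormula₂ (L := setLang k)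
        (SetRel.mem : SetRel k 2) (Term.var (Sum.inr 0)) (Term.var (Sum.inr 1)))))) ↔
      (∃ _ : {x : ZFSet.{u} // x ∈ V_ β}, True) ∧
        ∀ x : {x : ZFSet.{u} // x ∈ V_ β}, ∃ y : {x : ZFSet.{u} // x ∈ V_ β}, x.1 ∈ y.1 := by
    rw [Sentence.Realize, Formula.Realize, BoundedFormula.realize_inf, BoundedFormula.realize_ex]
    simp only [BoundedFormula.realize_top, BoundedFormula.realize_all, BoundedFormula.realize_ex]
    rfl
  rw [h]
  constructor
  · rintro ⟨⟨x, -⟩, h⟩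
    refine ⟨fun hm => ?_, fun γ hγ => ?_⟩
    · have := (mem_vonNeumann.1 x.2)
      exact hm.not_lt this
    · obtain ⟨⟨y, hy⟩, hy'⟩ := h ⟨V_ γ, vonNeumann_mem_of_lt hγ.lt⟩
      have h1 := rank_lt_of_mem hy'
      rw [rank_vonNeumann] at h1
      exact hγ.2 h1 (mem_vonNeumann.1 hy)
  · intro hβ
    refine ⟨⟨⟨∅, empty_mem_vonNeumann hβ⟩, trivial⟩, fun x => ⟨⟨{x.1}, ?_⟩, by simp⟩⟩
    rw [mem_vonNeumann, rank_singleton]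
    exact hβ.succ_lt (mem_vonNeumann.1 x.2)

/-! ### The universal properties are expressible -/

/-- A finite sequence of predicates, continued by `∅`. -/
def stream {k : ℕ} (X : Fin k → ZFSet.{u}) (i : ℕ) : Set ZFSet.{u} :=
  {x | ∃ h : i < k, x ∈ X ⟨i, h⟩}

/-- The join of the left component of `G 0` with `G 1`, …, `G j`. -/
def iterJoin (G : ℕ → Set ZFSet.{u}) : ℕ → Set ZFSet.{u}
  | 0 => left (G 0)
  | j + 1 => join (iterJoin G j) (G (j + 1))

theorem definableClass_stream {k : ℕ} (j : ℕ) :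
    DefinableClass (fun X : Fin k → ZFSet.{u} => stream X j) := fun i => by
  by_cases h : j < k
  · exact (FODefinable.pred ⟨j, h⟩ i).congr fun β _ X v _ => ⟨fun ⟨_, hx⟩ => hx, fun hx => ⟨h, hx⟩⟩
  · exact FODefinable.false.congr fun β _ X v _ => ⟨fun ⟨h', _⟩ => h h', False.elim⟩

theorem definableClass_iterJoin {k : ℕ} (j : ℕ) :
    DefinableClass (fun X : Fin k → ZFSet.{u} => iterJoin (stream X) j) := by
  induction j with
  | zero => exact (definableClass_stream 0).left
  | succ j ih => exact ih.join (definableClass_stream (j + 1))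

theorem stream_append_of_lt {k m i : ℕ} (hi : i < k) (X : Fin k → ZFSet.{u})
    (Y : Fin m → ZFSet.{u}) : stream (Fin.append X Y) i = stream X i := by
  have h : Fin.append X Y ⟨i, by omega⟩ = X ⟨i, hi⟩ := Fin.append_left X Y ⟨i, hi⟩
  ext x
  exact ⟨fun ⟨_, hx⟩ => ⟨hi, h ▸ hx⟩, fun ⟨_, hx⟩ => ⟨by omega, h ▸ hx⟩⟩

theorem stream_append_self {k : ℕ} (X : Fin k → ZFSet.{u}) (Y : Fin 1 → ZFSet.{u}) :
    stream (Fin.append X Y) k = {x | x ∈ Y 0} := by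
  have h : Fin.append X Y ⟨k, by omega⟩ = Y 0 := Fin.append_right X Y 0
  ext x
  exact ⟨fun ⟨_, hx⟩ => h ▸ hx, fun hx => ⟨by omega, h ▸ hx⟩⟩

theorem iterJoin_congr {G G' : ℕ → Set ZFSet.{u}} {j : ℕ} (h : ∀ i ≤ j, G i = G' i) :
    iterJoin G j = iterJoin G' j := by
  induction j with
  | zero => rw [iterJoin, iterJoin, h 0 le_rfl]
  | succ j ih => rw [iterJoin, iterJoin, h _ le_rfl, ih fun i hi => h i (by omega)]

/-- The normal form whose relation is coded by the first predicate, after the quantification of the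
predicates `1, …, j`. -/
def NormalFormAt (β : Ordinal.{u}) (n j : ℕ) (X : Fin (j + 1) → ZFSet.{u}) : Prop :=
  NormalForm β (codedRel (right (stream X 0))) n (iterJoin (stream X) j)

theorem forall_normalFormAt_iff {β : Ordinal.{u}} {n j : ℕ} (X : Fin (j + 1) → ZFSet.{u})
    (Q : Prop → Prop) :
    (∀ Y : Fin 1 → ZFSet.{u}, (∀ i, Y i ⊆ V_ β) →
      Q (NormalFormAt β n (j + 1) (Fin.append X Y))) ↔
    ∀ Y : Set ZFSet.{u}, Q (NormalForm β (codedRel (right (stream X 0))) n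
      (join (iterJoin (stream X) j) Y)) := by
  have key : ∀ Y : Fin 1 → ZFSet.{u}, NormalFormAt β n (j + 1) (Fin.append X Y) ↔
      NormalForm β (codedRel (right (stream X 0))) n
        (join (iterJoin (stream X) j) {x | x ∈ Y 0}) := by
    intro Y
    rw [NormalFormAt, iterJoin, stream_append_of_lt (by omega), stream_append_self,
      iterJoin_congr fun i hi => stream_append_of_lt (by omega) X Y]
  constructor
  · intro h Y
    have h1 := h (fun _ => (V_ β).sep (· ∈ Y)) fun _ => ZFSet.sep_subset
    rw [key] at h1
    convert h1 using 1
    refine (normalForm_congr fun z hz => or_congr_right ?_)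
    refine exists_congr fun x => and_congr_left ?_
    rintro rfl
    have : x ∈ V_ β :=
      mem_vonNeumann.2 ((rank_right_le_rank_pair _ _).trans_lt (mem_vonNeumann.1 hz))
    simp [this]
  · intro h Y _
    rw [key]
    exact h _

/-- The quantifier prefix is built from the inside. Being a limit ordinal is carried along as a
conjunct or as a premise, since the matrix is under control at limit ordinals only. -/
theorem exists_formula_normalFormAt (n j : ℕ) :
    (∃ φ : SOFormula .pi n (j + 1), ∀ (β : Ordinal.{u}) X,
      φ.Holds β X ↔ IsSuccLimit β ∧ NormalFormAt β n j X) ∧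
    (∃ φ : SOFormula .pi n (j + 1), ∀ (β : Ordinal.{u}) X,
      φ.Holds β X ↔ (IsSuccLimit β → NormalFormAt β n j X)) ∧
    (∃ φ : SOFormula .sigma n (j + 1), ∀ (β : Ordinal.{u}) X,
      φ.Holds β X ↔ ¬ (IsSuccLimit β ∧ NormalFormAt β n j X)) ∧
    (∃ φ : SOFormula .sigma n (j + 1), ∀ (β : Ordinal.{u}) X,
      φ.Holds β X ↔ ¬ (IsSuccLimit β → NormalFormAt β n j X)) := by
  induction n generalizing j with
  | zero =>
    obtain ⟨lim, hlim⟩ := exists_limit_sentence.{u} (j + 1)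
    obtain ⟨ψ, hψ⟩ := (FODefinable.normalForm_zero (definableClass_iterJoin.{u} (k := j + 1) j)
      (definableClass_stream 0).right).exists_sentence
    have hψ' : ∀ (β : Ordinal.{u}) X, IsSuccLimit β → (@Sentence.Realize _
        {x : ZFSet.{u} // x ∈ V_ β} (setStructure β X) ψ ↔ NormalFormAt β 0 j X) :=
      fun β X hβ => hψ β hβ X
    have hand : ∀ (β : Ordinal.{u}) X, @Sentence.Realize _ {x : ZFSet.{u} // x ∈ V_ β}
        (setStructure β X) (lim ⊓ ψ) ↔ IsSuccLimit β ∧ NormalFormAt β 0 j X := by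
      intro β X
      let := setStructure β X
      rw [Sentence.Realize, Formula.realize_inf]
      exact (and_congr_left fun _ => hlim β X).trans (and_congr_right (hψ' β X))
    have himp : ∀ (β : Ordinal.{u}) X, @Sentence.Realize _ {x : ZFSet.{u} // x ∈ V_ β}
        (setStructure β X) (lim.imp ψ) ↔ (IsSuccLimit β → NormalFormAt β 0 j X) := by
      intro β X
      let := setStructure β X
      rw [Sentence.Realize, Formula.realize_imp]
      exact (imp_congr_left (hlim β X)).trans (forall_congr' (hψ' β X))
    exact ⟨⟨.firstOrder (lim ⊓ ψ), hand⟩, ⟨.firstOrder (lim.imp ψ), himp⟩,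
      ⟨.firstOrder (lim ⊓ ψ).not, fun β X => not_congr (hand β X)⟩,
      ⟨.firstOrder (lim.imp ψ).not, fun β X => not_congr (himp β X)⟩⟩
  | succ n ih =>
    obtain ⟨⟨a, ha⟩, ⟨b, hb⟩, ⟨c, hc⟩, ⟨d, hd⟩⟩ := ih (j + 1)
    have hall : ∀ (β : Ordinal.{u}) X, NormalFormAt β (n + 1) j X ↔ ∀ Y : Fin 1 → ZFSet.{u},
        (∀ i, Y i ⊆ V_ β) → ¬ NormalFormAt β n (j + 1) (Fin.append X Y) :=
      fun β X => (forall_normalFormAt_iff X Not).symm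
    have hne : ∀ β : Ordinal.{u}, ∃ Y : Fin 1 → ZFSet.{u}, ∀ i, Y i ⊆ V_ β :=
      fun β => ⟨fun _ => ∅, fun _ => ZFSet.empty_subset _⟩
    refine ⟨⟨.all 1 d, fun β X => ?_⟩, ⟨.all 1 c, fun β X => ?_⟩, ⟨.ex 1 b, fun β X => ?_⟩,
      ⟨.ex 1 a, fun β X => ?_⟩⟩ <;> simp only [SOFormula.Holds, ha, hb, hc, hd, hall]
    · obtain ⟨Y₀, hY₀⟩ := hne β
      constructor
      · intro h
        exact ⟨(Classical.not_imp.1 (h Y₀ hY₀)).1, fun Y hY => (Classical.not_imp.1 (h Y hY)).2⟩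
      · rintro ⟨h1, h2⟩ Y hY h
        exact h2 Y hY (h h1)
    · exact ⟨fun h hβ Y hY hN => h Y hY ⟨hβ, hN⟩, fun h Y hY hN => h hN.1 Y hY hN.2⟩
    · obtain ⟨Y₀, hY₀⟩ := hne β
      constructor
      · rintro ⟨Y, hY, h⟩ ⟨hβ, h'⟩
        exact h' Y hY (h hβ)
      · intro h
        by_contra! hcon
        exact h ⟨(hcon Y₀ hY₀).1, fun Y hY => (hcon Y hY).2⟩
    · constructor
      · rintro ⟨Y, hY, hβ, h⟩ h'
        exact h' hβ Y hY h
      · intro h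
        by_contra! hcon
        exact h fun hβ Y hY => hcon Y hY hβ

theorem exists_formula_universal (n : ℕ) : ∃ φ : SOFormula .pi n 1, ∀ (β : Ordinal.{u}) A,
    φ.Holds β ![A] ↔ IsSuccLimit β ∧ Universal n β {x | x ∈ A} := by
  obtain ⟨⟨φ, hφ⟩, -⟩ := exists_formula_normalFormAt.{u} n 0
  refine ⟨φ, fun β A => (hφ β _).trans (and_congr_right fun _ => ?_)⟩
  have : stream ![A] 0 = {x | x ∈ A} := by ext x; simp [stream]
  rw [NormalFormAt, iterJoin, this, Universal]

/-! ### Indescribability as a local property -/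

/-- Every instance of truth of a `Π¹ₘ`-formula is implied by an instance of the universal local
`Π¹ₘ`-property. For `m = 0` the class `W` includes truth data over `V_β`, and the local matrix
ensures that they remain truth data over `V_γ`. -/
theorem exists_universal_of_holds {m : ℕ} (φ : SOFormula .pi m 1) {β : Ordinal.{u}}
    (hβ : IsSuccLimit β) (A : Set ZFSet.{u}) (h : φ.Holds β (restrict β fun _ => A)) :
    ∃ W, Universal m β W ∧
      ∀ γ, IsSuccLimit γ → Universal m γ W → φ.Holds γ (restrict γ fun _ => A) := by
  cases m with
  | zero =>
    obtain ⟨ψ⟩ := φ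
    obtain ⟨G, hG, hψ⟩ := exists_truth_data.{u} ψ
    obtain ⟨F, hF⟩ := (hψ β hβ _).1 h
    obtain ⟨W, hW⟩ := (hG (fun _ => left) right (fun _ => .left) .right).exists_universal (join A F)
    simp only [left_join, right_join] at hW
    exact ⟨W, (hW β hβ).1 hF, fun γ hγ h => (hψ γ hγ _).2 ⟨F, (hW γ hγ).2 h⟩⟩
  | succ m =>
    obtain ⟨W, hW⟩ := ((localPi_holds m).1 φ (fun _ J => J) fun _ => .id).exists_universal A
    exact ⟨W, (hW β hβ).1 h, fun γ hγ => (hW γ hγ).2⟩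

theorem restrict_eq_inter (β : Ordinal.{u}) (A : ZFSet.{u}) :
    (restrict β fun _ : Fin 1 => {x | x ∈ A}) = ![A ∩ V_ β] := by
  funext i
  ext x
  simp [restrict, and_comm]

/-- At limit ordinals, reflecting all instances of the universal local `Π¹ₙ`-property suffices for
`Π¹ₙ`-indescribability. -/
theorem isIndescribableSet_iff {n : ℕ} {β : Ordinal.{u}} (hβ : IsSuccLimit β)
    {D : Set Ordinal.{u}} : IsIndescribableSet n β D ↔ D ⊆ Iio β ∧
      ∀ W, Universal n β W → ∃ γ ∈ D, IsSuccLimit γ ∧ Universal n γ W := by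
  refine and_congr_right fun hD => ⟨fun h W hW => ?_, fun h A hA φ hφ => ?_⟩
  · obtain ⟨φ, hφ⟩ := exists_formula_universal.{u} n
    have hagree : ∀ γ ≤ β, ∀ x ∈ V_ γ, x ∈ W ↔ x ∈ {x | x ∈ (V_ β).sep (· ∈ W) ∩ V_ γ} := by
      intro γ hγ x hx
      have := vonNeumann_subset_of_le hγ hx
      simp [hx, this]
    have hsub : (V_ β).sep (· ∈ W) ⊆ V_ β := ZFSet.sep_subset
    obtain ⟨γ, hγD, hγ⟩ := h _ hsub φ ((hφ β _).2 ⟨hβ, by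
      have := ((localPi_universal n).iff_of_agree hβ (hagree β le_rfl)).1 hW
      rwa [inter_eq_left_of_subset hsub] at this⟩)
    obtain ⟨hγlim, hγ⟩ := (hφ γ _).1 hγ
    exact ⟨γ, hγD, hγlim,
      ((localPi_universal n).iff_of_agree hγlim (hagree γ (hD hγD).le)).2 hγ⟩
  · have h1 : φ.Holds β (restrict β fun _ => {x | x ∈ A}) := by
      rwa [restrict_eq_inter, inter_eq_left_of_subset hA]
    obtain ⟨W, hW, hW'⟩ := exists_universal_of_holds φ hβ _ h1
    obtain ⟨γ, hγD, hγ, hγW⟩ := h W hW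
    refine ⟨γ, hγD, ?_⟩
    rw [← restrict_eq_inter]
    exact hW' γ hγ hγW

theorem IsIndescribableSet.exists_of_localPi {n : ℕ} {β : Ordinal.{u}} {D : Set Ordinal.{u}}
    (hD : IsIndescribableSet n β D) (hβ : IsSuccLimit β)
    {P : Ordinal.{u} → Set ZFSet.{u} → Prop} (hP : LocalPi n P) {J : Set ZFSet.{u}}
    (h : P β J) : ∃ γ ∈ D, IsSuccLimit γ ∧ P γ J := by
  obtain ⟨W, hW⟩ := hP.exists_universal J
  obtain ⟨γ, hγD, hγ, hγW⟩ := ((isIndescribableSet_iff hβ).1 hD).2 W ((hW β hβ).1 h)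
  exact ⟨γ, hγD, hγ, (hW γ hγ).2 hγW⟩

theorem IsIndescribableSet.mono {m n : ℕ} {β : Ordinal.{u}} {D : Set Ordinal.{u}}
    (hD : IsIndescribableSet n β D) (hβ : IsSuccLimit β) (hmn : m ≤ n) :
    IsIndescribableSet m β D :=
  (isIndescribableSet_iff hβ).2 ⟨hD.1, fun _ hW =>
    hD.exists_of_localPi hβ ((localPi_universal m).mono hmn) hW⟩

theorem exists_formula_of_sentence {k : ℕ} (ψ : (setLang k).Sentence) (s : Side) (n : ℕ) :
    ∃ φ : SOFormula s n k, ∀ (β : Ordinal.{u}) X, φ.Holds β X ↔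
      @Sentence.Realize _ {x : ZFSet.{u} // x ∈ V_ β} (setStructure β X) ψ := by
  have happ : ∀ (X : Fin k → ZFSet.{u}) (Y : Fin 0 → ZFSet.{u}), Fin.append X Y = X := by
    intro X Y
    rw [Subsingleton.elim Y Fin.elim0, Fin.append_elim0]
    rfl
  induction n generalizing s with
  | zero => exact ⟨.firstOrder ψ, fun _ _ => Iff.rfl⟩
  | succ n ih =>
    cases s with
    | pi =>
      obtain ⟨φ, hφ⟩ := ih .sigma
      refine ⟨.all 0 φ, fun β X => ?_⟩
      simp only [SOFormula.Holds, ← hφ]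
      exact ⟨fun h => happ X Fin.elim0 ▸ h Fin.elim0 fun i => i.elim0,
        fun h Y _ => (happ X Y).symm ▸ h⟩
    | sigma =>
      obtain ⟨φ, hφ⟩ := ih .pi
      refine ⟨.ex 0 φ, fun β X => ?_⟩
      simp only [SOFormula.Holds, ← hφ]
      exact ⟨fun ⟨Y, _, h⟩ => happ X Y ▸ h,
        fun h => ⟨Fin.elim0, fun i => i.elim0, (happ X Fin.elim0).symm ▸ h⟩⟩

/-- An indescribable ordinal is a limit: a successor `γ + 1` is described by the statement that
the predicate `{V_γ}` is not empty. -/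
theorem IsIndescribable.isSuccLimit {n : ℕ} {β : Ordinal.{u}} (h : IsIndescribable n β) :
    IsSuccLimit β := by
  obtain ⟨φ, hφ⟩ := exists_formula_of_sentence.{u} (k := 1) (BoundedFormula.ex
    (Relations.boundedFormula₁ (L := setLang 1) (SetRel.pred 0 : SetRel 1 1)
      (Term.var (Sum.inr 0)))) .pi n
  have hφ' : ∀ (γ : Ordinal.{u}) A, φ.Holds γ ![A] ↔ ∃ x ∈ V_ γ, x ∈ A := by
    intro γ A
    rw [hφ]
    let := setStructure γ ![A]
    rw [Sentence.Realize, Formula.Realize, BoundedFormula.realize_ex]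
    exact ⟨fun ⟨x, hx⟩ => ⟨x.1, x.2, hx⟩, fun ⟨x, hx, hA⟩ => ⟨⟨x, hx⟩, hA⟩⟩
  have key : ∀ γ, ¬ γ ⋖ β := by
    intro γ hγ
    have hmem := vonNeumann_mem_of_lt hγ.lt
    obtain ⟨α, hα, hA⟩ := h.2 {V_ γ} (fun x hx => by rwa [ZFSet.mem_singleton.1 hx]) φ
      ((hφ' _ _).2 ⟨_, hmem, ZFSet.mem_singleton.2 rfl⟩)
    obtain ⟨x, hx, hxA⟩ := (hφ' _ _).1 hA
    obtain rfl := ZFSet.mem_singleton.1 (ZFSet.mem_inter.1 hxA).1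
    exact hγ.2 (vonNeumann_mem_vonNeumann_iff.1 hx) hα
  refine ⟨fun hmin => ?_, key⟩
  obtain ⟨ψ, hψ⟩ := exists_formula_of_sentence.{u} (k := 1) ⊤ .pi n
  obtain ⟨α, hα, -⟩ := h.2 ∅ (ZFSet.empty_subset _) ψ ((hψ _ _).2 (by
    let := setStructure β ![(∅ : ZFSet.{u})]
    exact BoundedFormula.realize_top.2 trivial))
  exact hmin.not_lt hα

/-- The ordinals below `β` whose von Neumann ordinals belong to the class `J`. -/
def ordinals (β : Ordinal.{u}) (J : Set ZFSet.{u}) : Set Ordinal.{u} :=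
  {γ | γ < β ∧ γ.toZFSet ∈ J}

theorem ordinals_subset (β : Ordinal.{u}) (J : Set ZFSet.{u}) : ordinals β J ⊆ Iio β :=
  fun _ h => h.1

theorem ordinals_inter_Iio {α β : Ordinal.{u}} (h : α ≤ β) (J : Set ZFSet.{u}) :
    ordinals β J ∩ Iio α = ordinals α J := by
  ext γ
  exact ⟨fun ⟨h1, h2⟩ => ⟨h2, h1.2⟩, fun h1 => ⟨⟨h1.1.trans_le h, h1.2⟩, h1.1⟩⟩

theorem ordinals_univ (β : Ordinal.{u}) : ordinals β univ = Iio β := by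
  ext γ
  simp [ordinals]

theorem ordinals_image {γ : Ordinal.{u}} {C : Set Ordinal.{u}} :
    ordinals γ (Ordinal.toZFSet '' C) = C ∩ Iio γ := by
  ext δ
  simp [ordinals, Ordinal.toZFSet_injective.mem_set_image, and_comm]

theorem toZFSet_mem_vonNeumann {γ β : Ordinal.{u}} : γ.toZFSet ∈ V_ β ↔ γ < β := by
  rw [mem_vonNeumann, Ordinal.rank_toZFSet]

/-- A condition on an ordinal `γ` that depends only on `J ∩ V_γ` is local. -/
theorem isLocal_toZFSet {p : Ordinal.{u} → Set ZFSet.{u} → Prop}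
    (h : ∀ γ J J', (∀ x ∈ V_ γ, x ∈ J ↔ x ∈ J') → p γ J → p γ J') :
    IsLocal (fun c (_ : ZFSet.{u}) J => ∃ γ : Ordinal.{u}, c = γ.toZFSet ∧ p γ J) := by
  refine ⟨0, fun c y J J' hJ => ?_⟩
  rintro ⟨γ, rfl, hγ⟩
  refine ⟨γ, rfl, h γ J J' (fun x hx => hJ x ?_) hγ⟩
  rw [mem_vonNeumann] at hx
  rw [Ordinal.rank_toZFSet]
  exact (hx.le.trans (le_max_left _ _)).trans le_self_add

theorem ordinals_congr {γ : Ordinal.{u}} {J J' : Set ZFSet.{u}}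
    (h : ∀ x ∈ V_ γ, x ∈ J ↔ x ∈ J') : ordinals γ J = ordinals γ J' := by
  ext δ
  exact and_congr_right fun hδ => h _ (toZFSet_mem_vonNeumann.2 hδ)

/-- `Π¹ₙ₋₁`-indescribability is a local `Π¹ₙ`-property: for `n = m + 1` it says that there is no `W`
for which the universal `Π¹ₘ`-property holds at `β` and fails at all limit ordinals in the set. -/
theorem localPi_isPrevIndescribableSet (n : ℕ) :
    LocalPi n fun (β : Ordinal.{u}) J => IsPrevIndescribableSet n β (ordinals β J) := by
  cases n with
  | zero =>
    have h : IsLocal (fun c y J => (∃ γ : Ordinal.{u}, y = γ.toZFSet ∧ rank c < γ) ∧ y ∈ J) :=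
      (IsLocal.const fun c y => ∃ γ : Ordinal.{u}, y = γ.toZFSet ∧ rank c < γ).and .mem_right
    refine h.localPi_zero.congr fun β hβ J => ?_
    constructor
    · rintro ⟨-, -, h⟩ c hc
      obtain ⟨γ, hγ, hcγ⟩ := h _ (mem_vonNeumann.1 hc)
      exact ⟨_, toZFSet_mem_vonNeumann.2 hγ.1, ⟨γ, rfl, hcγ⟩, hγ.2⟩
    · refine fun h => ⟨hβ, ordinals_subset _ _, fun γ hγ => ?_⟩
      obtain ⟨_, hy, ⟨δ, rfl, hδ⟩, hJ⟩ := h _ (toZFSet_mem_vonNeumann.2 hγ)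
      rw [Ordinal.rank_toZFSet] at hδ
      exact ⟨δ, ⟨toZFSet_mem_vonNeumann.1 hy, hJ⟩, hδ⟩
  | succ m =>
    have h1 : IsLocal (fun c (_ : ZFSet.{u}) J => ∃ γ : Ordinal.{u}, c = γ.toZFSet ∧
        (IsSuccLimit γ ∧ Universal m γ J)) :=
      isLocal_toZFSet fun γ J J' hJ h =>
        ⟨h.1, ((localPi_universal m).iff_of_agree h.1 hJ).1 h.2⟩
    have h2 := IsLocal.localPi_zero_forall (Δ := fun c _ J => ¬ (c ∈ left J ∧
      ∃ γ : Ordinal.{u}, c = γ.toZFSet ∧ (IsSuccLimit γ ∧ Universal m γ (right J))))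
      ((IsLocal.mem_left.comp .left).and (h1.comp .right)).not
    refine (((localPi_universal m).comp .right).and (h2.mono m.zero_le)).forall_not.congr
      fun β hβ J => ?_
    rw [IsPrevIndescribableSet, isIndescribableSet_iff hβ, and_iff_right (ordinals_subset _ _)]
    refine forall_congr' fun W => ?_
    simp only [left_join, right_join]
    constructor
    · rintro h ⟨hW, hn⟩
      obtain ⟨γ, hγ, hγ'⟩ := h hW
      exact hn _ (toZFSet_mem_vonNeumann.2 hγ.1) ⟨hγ.2, γ, rfl, hγ'⟩
    · intro h hW
      by_contra hcon
      refine h ⟨hW, ?_⟩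
      rintro _ hc ⟨hJ, γ, rfl, hγ⟩
      exact hcon ⟨γ, ⟨toZFSet_mem_vonNeumann.1 hc, hJ⟩, hγ⟩

/-! ### Clubs and threads -/

/-- The definition of `n`-clubs for `n ≥ 1` also describes the clubs in a limit ordinal. -/
theorem isNClub_iff (n : ℕ) {κ : Ordinal.{u}} (hκ : IsSuccLimit κ) (E : Set Ordinal.{u}) :
    IsNClub n κ E ↔ IsPrevIndescribableSet n κ E ∧
      ∀ α < κ, IsPrevIndescribableSet n α (E ∩ Iio α) → α ∈ E := by
  cases n with
  | succ n => rfl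
  | zero =>
    constructor
    · rintro ⟨hE, hclub⟩
      refine ⟨⟨hκ, hE, fun β hβ => ?_⟩, fun α hα h => ?_⟩
      · obtain ⟨γ, hγ, hβγ⟩ := hclub.isCofinal ⟨succ β, hκ.succ_lt hβ⟩
        exact ⟨γ.1, hγ, (lt_succ β).trans_le hβγ⟩
      · obtain ⟨hlim, -, hub⟩ := h
        refine hclub.isLUB_mem (t := {x : Iio κ | x.1 ∈ E ∧ x.1 < α}) (x := ⟨α, hα⟩)
          (fun x hx => hx.1) ?_ ⟨fun x hx => hx.2.le, fun x hx => ?_⟩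
        · obtain ⟨γ, hγ, -⟩ := hub _ hlim.bot_lt
          exact ⟨⟨γ, hE hγ.1⟩, hγ⟩
        · by_contra! hlt
          obtain ⟨γ, hγ, hxγ⟩ := hub x.1 hlt
          have hle : (⟨γ, hE hγ.1⟩ : Iio κ) ≤ x := hx (a := ⟨γ, hE hγ.1⟩) hγ
          exact (show γ ≤ x.1 from hle).not_gt hxγ
    · rintro ⟨⟨-, hE, hub⟩, hcl⟩
      refine ⟨hE, fun d hd hne _ a ha => ?_, fun x => ?_⟩
      · by_cases had : a ∈ d
        · exact hd had
        have hcof : ∀ β < a.1, ∃ γ ∈ E ∩ Iio a.1, β < γ := by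
          intro β hβ
          obtain ⟨x, hx, hβx⟩ := (lt_isLUB_iff ha (b := ⟨β, hβ.trans a.2⟩)).1 hβ
          refine ⟨x.1, ⟨hd hx, lt_of_le_of_ne (ha.1 hx) fun h => had ?_⟩, hβx⟩
          rwa [← h]
        refine hcl a.1 a.2 ⟨⟨fun hmin => ?_, fun γ hγ => ?_⟩, inter_subset_right, hcof⟩
        · obtain ⟨x, hx⟩ := hne
          refine had ?_
          have : x = a := Subtype.ext (hmin.eq_of_le (ha.1 hx))
          rwa [← this]
        · obtain ⟨δ, hδ, hγδ⟩ := hcof γ hγ.lt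
          exact hγ.2 hγδ hδ.2
      · obtain ⟨γ, hγ, hxγ⟩ := hub x.1 x.2
        exact ⟨⟨γ, hE hγ⟩, hγ, hxγ.le⟩

/-- The class `D` codes an `n`-club in `β` that threads the sequence `C`, where `T` is the set of
indices. -/
def CodesThread (n : ℕ) (T : Set Ordinal.{u}) (C : Ordinal.{u} → Set Ordinal.{u})
    (β : Ordinal.{u}) (D : Set ZFSet.{u}) : Prop :=
  IsPrevIndescribableSet n β (ordinals β D) ∧
    ∀ γ < β, IsPrevIndescribableSet n γ (ordinals γ D) →
      γ.toZFSet ∈ D ∧ (γ ∈ T → C γ = ordinals γ D)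

theorem localPi_codesThread (n : ℕ) (T : Set Ordinal.{u}) (C : Ordinal.{u} → Set Ordinal.{u}) :
    LocalPi n (CodesThread n T C) := by
  have h1 : IsLocal (fun c (_ : ZFSet.{u}) D => ∃ γ : Ordinal.{u}, c = γ.toZFSet ∧
      IsPrevIndescribableSet n γ (ordinals γ D)) :=
    isLocal_toZFSet fun γ J J' hJ h => by rwa [← ordinals_congr hJ]
  have h2 : IsLocal (fun c (_ : ZFSet.{u}) D => ∃ γ : Ordinal.{u}, c = γ.toZFSet ∧
      (γ ∈ T → C γ = ordinals γ D)) :=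
    isLocal_toZFSet fun γ J J' hJ h => by rwa [← ordinals_congr hJ]
  have h3 := IsLocal.localPi_zero_forall (Δ := fun c _ D =>
    (∃ γ : Ordinal.{u}, c = γ.toZFSet ∧ IsPrevIndescribableSet n γ (ordinals γ D)) →
      (c ∈ D ∧ ∃ γ : Ordinal.{u}, c = γ.toZFSet ∧ (γ ∈ T → C γ = ordinals γ D)))
    (h1.imp (IsLocal.mem_left.and h2))
  refine ((localPi_isPrevIndescribableSet n).and (h3.mono n.zero_le)).congr fun β hβ D => ?_
  refine and_congr_right fun _ => ⟨fun h => ?_, fun h γ hγ hD => ?_⟩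
  · rintro _ hc ⟨γ, rfl, hγ⟩
    obtain ⟨h1, h2⟩ := h γ (toZFSet_mem_vonNeumann.1 hc) hγ
    exact ⟨h1, γ, rfl, h2⟩
  · obtain ⟨h1, δ, hδ, h2⟩ := h _ (toZFSet_mem_vonNeumann.2 hγ) ⟨γ, rfl, hD⟩
    obtain rfl := Ordinal.toZFSet_injective hδ
    exact ⟨h1, h2⟩

theorem CodesThread.isThread {n : ℕ} {κ : Ordinal.{u}} (hκ : IsSuccLimit κ)
    {C : Ordinal.{u} → Set Ordinal.{u}} {D : Set ZFSet.{u}}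
    (h : CodesThread n (prevTrace n κ (Iio κ)) C κ D) : IsThread n κ C (ordinals κ D) := by
  obtain ⟨h1, h2⟩ := h
  refine ⟨(isNClub_iff n hκ _).2 ⟨h1, fun α hα h => ?_⟩, fun α hα h => ?_⟩
  · rw [ordinals_inter_Iio hα.le] at h
    exact ⟨hα, (h2 α hα h).1⟩
  · rw [ordinals_inter_Iio hα.1.le] at h ⊢
    exact (h2 α hα.1 h).2 hα

/-- In a coherent sequence, every entry is a thread of its predecessors. -/
theorem IsCoherentSeq.codesThread {n : ℕ} {κ α : Ordinal.{u}} {C : Ordinal.{u} → Set Ordinal.{u}}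
    (hC : IsCoherentSeq n κ C) (hα : α ∈ prevTrace n κ (Iio κ)) (hlim : IsSuccLimit α) :
    CodesThread n (prevTrace n κ (Iio κ)) C α (Ordinal.toZFSet '' C α) := by
  obtain ⟨h1, h2⟩ := (isNClub_iff n hlim _).1 (hC.1 α hα)
  have hsub : C α ⊆ Iio α := by
    cases n with
    | zero => exact h1.2.1
    | succ n => exact h1.1
  refine ⟨?_, fun γ hγ h => ?_⟩
  · rwa [ordinals_image, inter_eq_left.2 hsub]
  · rw [ordinals_image] at h ⊢
    exact ⟨mem_image_of_mem _ (h2 γ hγ h), fun hγT => hC.2 γ hγT α hα hγ h⟩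

theorem IsIndescribable.isPrevIndescribableSet {n : ℕ} {κ : Ordinal.{u}}
    (h : IsIndescribable (n + 1) κ) : IsPrevIndescribableSet n κ (Iio κ) := by
  cases n with
  | zero =>
    exact ⟨h.isSuccLimit, subset_rfl, fun β hβ => ⟨succ β, h.isSuccLimit.succ_lt hβ, lt_succ β⟩⟩
  | succ n => exact IsIndescribableSet.mono h h.isSuccLimit (by omega)

/-- The square principle refutes indescribability at every ordinal. The property that is reflected
says that no class codes a thread and that the ordinal belongs to its own trace; at the ordinal `α`
to which it reflects, the entry `C α` of the sequence codes a thread. -/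
theorem SquarePrinciple.not_isIndescribable {n : ℕ} {κ : Ordinal.{u}}
    (h : SquarePrinciple n κ) : ¬ IsIndescribable (n + 1) κ := by
  intro hκ
  obtain ⟨-, C, hC, hno⟩ := h
  have hlim := hκ.isSuccLimit
  have h1 : LocalPi (n + 1) fun β _ => ∀ D, ¬ CodesThread n (prevTrace n κ (Iio κ)) C β D :=
    ((localPi_codesThread n (prevTrace n κ (Iio κ)) C).comp .right).forall_not.congr
      fun β _ J => by simp
  have h2 : LocalPi (n + 1) fun (β : Ordinal.{u}) _ => IsPrevIndescribableSet n β (Iio β) :=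
    ((localPi_isPrevIndescribableSet n).comp (.const univ)).succ.congr fun β _ J => by
      rw [ordinals_univ]
  obtain ⟨α, hα, hαlim, hnoα, hαprev⟩ := IsIndescribableSet.exists_of_localPi hκ hlim
    (h1.and h2) (J := ∅) ⟨fun D hD => hno ⟨_, hD.isThread hlim⟩, hκ.isPrevIndescribableSet⟩
  have hαT : α ∈ prevTrace n κ (Iio κ) :=
    ⟨hα, by rwa [inter_eq_right.2 (Iio_subset_Iio (le_of_lt hα))]⟩
  exact hnoα _ (hC.codesThread hαT hαlim)

end Indescribability

theorem mainTheorem9 (n : ℕ) (κ : Cardinal.{u})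
    (h : Indescribability.SquarePrinciple n κ.ord) :
    ¬ Indescribability.IsIndescribable (n + 1) κ.ord :=
  h.not_isIndescribable
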